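/- **Notation.** For a positive definite matrix $S$ let $\phi_p(\cdot\,;S)$ be the density of the centred normal law on $\mathbb R^p$ with covariance $S$ and $\Phi_p(\cdot\,;S)$ its distribution function ($\Phi_0=1$). For a covariance matrix $\Omega$ let $D_\Omega$ be the diagonal matrix of the square roots of its diagonal entries and $\bar\Omega=D_\Omega^{-1}\Omega D_\Omega^{-1}$. For $\xi\in\mathbb R^p$, $\Omega\in\mathbb R^{p\times p}$, $\Delta\in\mathbb R^{p\times s}$, $\gamma\in\mathbb R^s$, $\Gamma\in\mathbb R^{s\times s}$ with $\begin{bmatrix}\Gamma&\Delta^T\\ \Delta&\bar\Omega\end{bmatrix}$ positive definite, $\mathrm{SUN}_{p,s}(\xi,\Omega,\Delta,\gamma,\Gamma)$ is the law on $\mathbb R^p$ with density $$z\mapsto \phi_p(z-\xi;\Omega)\,\frac{\Phi_s\big(\gamma+\Delta^T\bar\Omega^{-1}D_\Omega^{-1}(z-\xi);\,\Gamma-\Delta^T\bar\Omega^{-1}\Delta\big)}{\Phi_s(\gamma;\Gamma)} .$$ Given $\xi:\mathbb R^d\to\mathbb R$, $\Omega:\mathbb R^d\times\mathbb R^d\to\mathbb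 R$, $\Delta:\mathbb R^d\to\mathbb R^s$, $\gamma\in\mathbb R^s$, $\Gamma\in\mathbb R^{s\times s}$, a random function $f:\mathbb R^d\to\mathbb R$ is $\mathrm{SkewGP}_s(\xi,\Omega,\Delta,\gamma,\Gamma)$ if for all distinct points $T=(t_1,\dots,t_k)$ the matrix $\begin{bmatrix}\Gamma&\Delta(T)^T\\ \Delta(T)&\bar\Omega(T,T)\end{bmatrix}$ is positive definite and $(f(t_1),\dots,f(t_k))\sim \mathrm{SUN}_{k,s}(\xi(T),\Omega(T,T),\Delta(T),\gamma,\Gamma)$, where $\xi(T)=(\xi(t_i))_i$, $\Omega(T,T)=(\Omega(t_i,t_j))_{i,j}$ and $\Delta(T)$ has rows $\Delta(t_i)^T$. **Theorem.** Let $f\sim \mathrm{SkewGP}_s(\xi,\Omega,\Delta,\gamma,\Gamma)$, let $X=(x_1,\dots,x_n)$ be distinct points of $\mathbb R^d$, $C\in\mathbb R^{m\times n}$, $R\in\mathbb R^{m\times m}$ symmetric positive definite, and let the observation $Y\in\mathbb R^m$ have, given $f$, the density $p(Y\mid f(X))=\phi_m(Y-Cf(X);R)$. Then for every $Y\in\mathbb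 R^m$ the posterior of $f$ given by Bayes' rule, $p(df\mid Y)=p(Y\mid f(X))\,p(df)/p(Y)$, is a probability law; these laws form a regular conditional distribution of $f$ given $Y$; and for every $Y$ the posterior of $f$ is $\mathrm{SkewGP}_s(\tilde\xi,\tilde\Omega,\tilde\Delta,\gamma_p,\Gamma_p)$, where, with $S=C\,\Omega(X,X)\,C^T+R$, $$\tilde\xi(x)=\xi(x)+\Omega(x,X)C^TS^{-1}(Y-C\xi(X)),$$ $$\tilde\Omega(x,x')=\Omega(x,x')-\Omega(x,X)C^TS^{-1}C\,\Omega(X,x'),$$ $$\tilde\Delta(x)^T=\tilde\Omega(x,x)^{-1/2}\Omega(x,x)^{1/2}\Delta(x)^T-\tilde\Omega(x,x)^{-1/2}\,\Omega(x,X)C^TS^{-1}C\,D_{\Omega(X,X)}\Delta(X),$$ and, writing $\xi,\Omega,\Delta$ for $\xi(X),\Omega(X,X),\Delta(X)$ in the following formulas, $$\xi_p=\xi+\Omega C^TS^{-1}(Y-C\xi),\qquad \Omega_p=\Omega-\Omega C^TS^{-1}C\Omega,\qquad \Delta_p=\bar\Omega_pD_{\Omega_p}D_\Omega^{-1}\bar\Omega^{-1}\Delta,$$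 $$\gamma_p=\gamma+\Delta^T\bar\Omega^{-1}D_\Omega^{-1}(\xi_p-\xi),\qquad \Gamma_p=\Gamma-\Delta^T\bar\Omega^{-1}\Delta+\Delta_p^T\bar\Omega_p^{-1}\Delta_p .$$ In particular the SkewGP family is conjugate to the normal likelihood. -/

import Mathlib

open MeasureTheory ProbabilityTheory
open scoped ENNReal Matrix

noncomputable section

namespace SkewGaussian

/-! ### Multivariate normal density and distribution function -/

/-- `φ(v; S)`: the density at `v` of the centred normal distribution with covariance `S`. -/
def mvnPDF {ι : Type*} [Fintype ι] [DecidableEq ι] (S : Matrix ι ι ℝ) (v : ι → ℝ) : ℝ :=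
  (√((2 * Real.pi) ^ Fintype.card ι * S.det))⁻¹ * Real.exp (-(v ⬝ᵥ (S⁻¹ *ᵥ v)) / 2)

/-- `Φ(a; S)`: the distribution function of the centred normal distribution with covariance `S`,
evaluated at the vector `a` (the integral is over all `t` with `t i ≤ a i` for every `i`). -/
def mvnCDF {ι : Type*} [Fintype ι] [DecidableEq ι] (S : Matrix ι ι ℝ) (a : ι → ℝ) : ℝ :=
  ∫ t in Set.Iic a, mvnPDF S t

/-! ### Unified skew-normal distributions -/

/-- `D_Ω`: the diagonal matrix of the square roots of the diagonal entries of `Ω`. -/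
def scaleDiag {ι : Type*} [DecidableEq ι] (Ω : Matrix ι ι ℝ) : Matrix ι ι ℝ :=
  Matrix.diagonal fun i => √(Ω i i)

/-- `Ω̄ = D_Ω⁻¹ Ω D_Ω⁻¹`: the correlation matrix of the covariance matrix `Ω`. -/
def corr {ι : Type*} [Fintype ι] [DecidableEq ι] (Ω : Matrix ι ι ℝ) : Matrix ι ι ℝ :=
  (scaleDiag Ω)⁻¹ * Ω * (scaleDiag Ω)⁻¹

/-- The block matrix `M = [Γ, Δᵀ; Δ, Ω̄]`, whose positive definiteness is the condition for the
unified skew-normal distribution with these parameters to be well defined. -/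
def sunMatrix {ι σ : Type*} [Fintype ι] [DecidableEq ι]
    (Ω : Matrix ι ι ℝ) (Δ : Matrix ι σ ℝ) (Γ : Matrix σ σ ℝ) : Matrix (σ ⊕ ι) (σ ⊕ ι) ℝ :=
  Matrix.fromBlocks Γ Δᵀ Δ (corr Ω)

/-- The density of `SUN(ξ, Ω, Δ, γ, Γ)`. -/
def sunPDF {ι σ : Type*} [Fintype ι] [DecidableEq ι] [Fintype σ] [DecidableEq σ]
    (ξ : ι → ℝ) (Ω : Matrix ι ι ℝ) (Δ : Matrix ι σ ℝ) (γ : σ → ℝ) (Γ : Matrix σ σ ℝ)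
    (z : ι → ℝ) : ℝ :=
  mvnPDF Ω (z - ξ) *
    (mvnCDF (Γ - Δᵀ * (corr Ω)⁻¹ * Δ) (γ + (Δᵀ * (corr Ω)⁻¹ * (scaleDiag Ω)⁻¹) *ᵥ (z - ξ)) /
      mvnCDF Γ γ)

/-- The distribution `SUN(ξ, Ω, Δ, γ, Γ)`: the measure with that density. -/
def sun {ι σ : Type*} [Fintype ι] [DecidableEq ι] [Fintype σ] [DecidableEq σ]
    (ξ : ι → ℝ) (Ω : Matrix ι ι ℝ) (Δ : Matrix ι σ ℝ) (γ : σ → ℝ) (Γ : Matrix σ σ ℝ) :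
    Measure (ι → ℝ) :=
  volume.withDensity fun z => ENNReal.ofReal (sunPDF ξ Ω Δ γ Γ z)

/-! ### Skew-Gaussian processes -/

section SkewProc

variable {E : Type*} {n s : ℕ}

/-- `ξ(X)`. -/
def locVec (ξ : E → ℝ) (X : Fin n → E) : Fin n → ℝ := fun i => ξ (X i)

/-- `Ω(X, X)`. -/
def scaleMat (Ω : E → E → ℝ) (X : Fin n → E) : Matrix (Fin n) (Fin n) ℝ :=
  Matrix.of fun i j => Ω (X i) (X j)

/-- `Δ(X)`, with one row `Δ(xᵢ)` for each point. -/
def skewMat (Δ : E → Fin s → ℝ) (X : Fin n → E) : Matrix (Fin n) (Fin s) ℝ :=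
  Matrix.of fun i => Δ (X i)

/-- `P`, a law on the functions `E → ℝ` with the product σ-algebra, is the law of
`SkewGP_s(ξ, Ω, Δ, γ, Γ)`: for every finite sequence of distinct points the matrix `M` is positive
definite and the vector of the values at these points has the corresponding SUN distribution. -/
structure IsSkewGP (P : Measure (E → ℝ)) (ξ : E → ℝ) (Ω : E → E → ℝ) (Δ : E → Fin s → ℝ)
    (γ : Fin s → ℝ) (Γ : Matrix (Fin s) (Fin s) ℝ) : Prop where
  posDef : ∀ (k : ℕ) (T : Fin k → E), Function.Injective T →
    (sunMatrix (scaleMat Ω T) (skewMat Δ T) Γ).PosDef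
  map_eq : ∀ (k : ℕ) (T : Fin k → E), Function.Injective T →
    P.map (fun f i => f (T i)) = sun (locVec ξ T) (scaleMat Ω T) (skewMat Δ T) γ Γ

end SkewProc

/-! ### Likelihoods and Bayes' rule -/

section Bayes

variable {Θ 𝒴 : Type*} [MeasurableSpace Θ] [MeasurableSpace 𝒴]

/-- The observation model: given `θ`, the observation has density `L θ` with respect to `ν`. -/
def likelihoodKernel (ν : Measure 𝒴) [SFinite ν] (L : Θ → 𝒴 → ℝ≥0∞) : Kernel Θ 𝒴 :=
  (Kernel.const Θ ν).withDensity L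

/-- The posterior `p(θ ∣ y) = p(y ∣ θ) p(θ) / p(y)`, where `p(y) = ∫ p(y ∣ θ) p(dθ)`. -/
def bayesPosterior (μ : Measure Θ) [SFinite μ] (L : Θ → 𝒴 → ℝ≥0∞) : Kernel 𝒴 Θ :=
  (Kernel.const 𝒴 μ).withDensity fun y θ => L θ y / ∫⁻ θ', L θ' y ∂μ

theorem likelihoodKernel_apply (ν : Measure 𝒴) [SFinite ν] {L : Θ → 𝒴 → ℝ≥0∞}
    (hL : Measurable (Function.uncurry L)) (θ : Θ) :
    likelihoodKernel ν L θ = ν.withDensity (L θ) := by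
  rw [likelihoodKernel, Kernel.withDensity_apply _ hL, Kernel.const_apply]

theorem bayesPosterior_apply (μ : Measure Θ) [SFinite μ] {L : Θ → 𝒴 → ℝ≥0∞}
    (hL : Measurable (Function.uncurry L)) (y : 𝒴) :
    bayesPosterior μ L y = μ.withDensity fun θ => L θ y / ∫⁻ θ', L θ' y ∂μ := by
  have h : Measurable (Function.uncurry fun (y : 𝒴) (θ : Θ) => L θ y) :=
    hL.comp measurable_swap
  have h' : Measurable fun y : 𝒴 => ∫⁻ θ', L θ' y ∂μ := h.lintegral_prod_right
  rw [bayesPosterior, Kernel.withDensity_apply, Kernel.const_apply]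
  exact h.div (h'.comp measurable_fst)

end Bayes

/-! ### The normal likelihood and the posterior parameters -/

section Posterior

variable {E : Type*} {n m s : ℕ}

/-- The normal likelihood `p(y ∣ f(X)) = φ(y - C f(X); R)`. -/
def normalLikelihood (X : Fin n → E) (C : Matrix (Fin m) (Fin n) ℝ) (R : Matrix (Fin m) (Fin m) ℝ)
    (f : E → ℝ) (y : Fin m → ℝ) : ℝ≥0∞ :=
  ENNReal.ofReal (mvnPDF R (y - C *ᵥ fun i => f (X i)))

theorem measurable_normalLikelihood (X : Fin n → E) (C : Matrix (Fin m) (Fin n) ℝ)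
    (R : Matrix (Fin m) (Fin m) ℝ) :
    Measurable (Function.uncurry (normalLikelihood X C R)) := by
  have h1 : Continuous (mvnPDF R) := by
    unfold mvnPDF
    fun_prop
  have h2 : Measurable fun p : (E → ℝ) × (Fin m → ℝ) => p.2 - C *ᵥ fun i => p.1 (X i) := by
    have h3 : Continuous fun v : Fin n → ℝ => C *ᵥ v := by fun_prop
    refine measurable_snd.sub (h3.measurable.comp ?_)
    fun_prop
  exact (h1.measurable.comp h2).ennreal_ofReal

/-- `Ω(x, X)`. -/
def crossScale (Ω : E → E → ℝ) (x : E) (X : Fin n → E) : Fin n → ℝ := fun j => Ω x (X j)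

/-- `(C Ω(X, X) Cᵀ + R)⁻¹`. -/
def obsPrec (Ω : E → E → ℝ) (X : Fin n → E) (C : Matrix (Fin m) (Fin n) ℝ)
    (R : Matrix (Fin m) (Fin m) ℝ) : Matrix (Fin m) (Fin m) ℝ :=
  (C * scaleMat Ω X * Cᵀ + R)⁻¹

/-- The posterior location function
`ξ(x) + Ω(x, X) Cᵀ (C Ω(X, X) Cᵀ + R)⁻¹ (y - C ξ(X))`. -/
def postLoc (ξ : E → ℝ) (Ω : E → E → ℝ) (X : Fin n → E) (C : Matrix (Fin m) (Fin n) ℝ)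
    (R : Matrix (Fin m) (Fin m) ℝ) (y : Fin m → ℝ) (x : E) : ℝ :=
  ξ x + crossScale Ω x X ⬝ᵥ ((Cᵀ * obsPrec Ω X C R) *ᵥ (y - C *ᵥ locVec ξ X))

/-- The posterior scale function
`Ω(x, x') - Ω(x, X) Cᵀ (C Ω(X, X) Cᵀ + R)⁻¹ C Ω(X, x')`. -/
def postScale (Ω : E → E → ℝ) (X : Fin n → E) (C : Matrix (Fin m) (Fin n) ℝ)
    (R : Matrix (Fin m) (Fin m) ℝ) (x x' : E) : ℝ :=
  Ω x x' - crossScale Ω x X ⬝ᵥ ((Cᵀ * obsPrec Ω X C R * C) *ᵥ fun j => Ω (X j) x')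

/-- The posterior skewness function, where `Ω̃` is the posterior scale function:
`Ω̃(x, x)^(-1/2) Ω(x, x)^(1/2) Δ(x)
  - Ω̃(x, x)^(-1/2) Ω(x, X) Cᵀ (C Ω(X, X) Cᵀ + R)⁻¹ C D_{Ω(X, X)} Δ(X)`. -/
def postSkew (Ω : E → E → ℝ) (Δ : E → Fin s → ℝ) (X : Fin n → E) (C : Matrix (Fin m) (Fin n) ℝ)
    (R : Matrix (Fin m) (Fin m) ℝ) (x : E) : Fin s → ℝ :=
  ((√(postScale Ω X C R x x))⁻¹ * √(Ω x x)) • Δ x -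
    (√(postScale Ω X C R x x))⁻¹ •
      (crossScale Ω x X ᵥ*
        (Cᵀ * obsPrec Ω X C R * C * scaleDiag (scaleMat Ω X) * skewMat Δ X))

/-- `ξ_p = ξ + Ω Cᵀ (C Ω Cᵀ + R)⁻¹ (y - C ξ)` at the training points. -/
def xiP (ξ : E → ℝ) (Ω : E → E → ℝ) (X : Fin n → E) (C : Matrix (Fin m) (Fin n) ℝ)
    (R : Matrix (Fin m) (Fin m) ℝ) (y : Fin m → ℝ) : Fin n → ℝ :=
  locVec ξ X + (scaleMat Ω X * Cᵀ * obsPrec Ω X C R) *ᵥ (y - C *ᵥ locVec ξ X)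

/-- `Ω_p = Ω - Ω Cᵀ (C Ω Cᵀ + R)⁻¹ C Ω` at the training points. -/
def omegaP (Ω : E → E → ℝ) (X : Fin n → E) (C : Matrix (Fin m) (Fin n) ℝ)
    (R : Matrix (Fin m) (Fin m) ℝ) : Matrix (Fin n) (Fin n) ℝ :=
  scaleMat Ω X - scaleMat Ω X * Cᵀ * obsPrec Ω X C R * C * scaleMat Ω X

/-- `Δ_p = Ω̄_p D_{Ω_p} D_Ω⁻¹ Ω̄⁻¹ Δ` at the training points. -/
def deltaP (Ω : E → E → ℝ) (Δ : E → Fin s → ℝ) (X : Fin n → E) (C : Matrix (Fin m) (Fin n) ℝ)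
    (R : Matrix (Fin m) (Fin m) ℝ) : Matrix (Fin n) (Fin s) ℝ :=
  corr (omegaP Ω X C R) * scaleDiag (omegaP Ω X C R) * (scaleDiag (scaleMat Ω X))⁻¹ *
    (corr (scaleMat Ω X))⁻¹ * skewMat Δ X

/-- `γ_p = γ + Δᵀ Ω̄⁻¹ D_Ω⁻¹ (ξ_p - ξ)`. -/
def gammaP (ξ : E → ℝ) (Ω : E → E → ℝ) (Δ : E → Fin s → ℝ) (γ : Fin s → ℝ) (X : Fin n → E)
    (C : Matrix (Fin m) (Fin n) ℝ) (R : Matrix (Fin m) (Fin m) ℝ) (y : Fin m → ℝ) : Fin s → ℝ :=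
  γ + ((skewMat Δ X)ᵀ * (corr (scaleMat Ω X))⁻¹ * (scaleDiag (scaleMat Ω X))⁻¹) *ᵥ
    (xiP ξ Ω X C R y - locVec ξ X)

/-- `Γ_p = Γ - Δᵀ Ω̄⁻¹ Δ + Δ_pᵀ Ω̄_p⁻¹ Δ_p`. -/
def capGammaP (Ω : E → E → ℝ) (Δ : E → Fin s → ℝ) (Γ : Matrix (Fin s) (Fin s) ℝ) (X : Fin n → E)
    (C : Matrix (Fin m) (Fin n) ℝ) (R : Matrix (Fin m) (Fin m) ℝ) : Matrix (Fin s) (Fin s) ℝ :=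
  Γ - (skewMat Δ X)ᵀ * (corr (scaleMat Ω X))⁻¹ * skewMat Δ X +
    (deltaP Ω Δ X C R)ᵀ * (corr (omegaP Ω X C R))⁻¹ * deltaP Ω Δ X C R

end Posterior

end SkewGaussian

end

open SkewGaussian

/-! A SUN law is a selection law. Let `(t, z)` be centred normal with covariance `sunCov`, that is
`[Γ, -(DΔ)ᵀ; -DΔ, Ω]` with `D = D_Ω`; then `ξ + z` conditioned on `t ≤ γ` is `SUN(ξ, Ω, Δ, γ, Γ)`
(`sun_eq_smul_selectionLaw`). The skewing factor of the density is the conditional probability of `t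
≤ γ` given `z`.

A normal likelihood in `z` only reweights the underlying normal law of `(t, z)`. By Gaussian
conjugacy the result is a constant times a normal law with covariance `condCov`, translated by some
`u` (`gaussianLaw_withDensity`). Under the constraint `t ≤ γ`, the translation lowers the threshold
by the `t`-part of `u` and raises the location by its `z`-part, so the result is again a selection
law (`selectionLaw_withDensity`).

For a process, this is applied on a finite set containing both the test and the training points,
then marginalised to the test points. What remains is algebra: the blocks of `condCov` are those of
`sunCov` for the stated posterior parameters (`condCov_submatrix_eq`). Normalising constants need
not be computed, since both sides are probability laws. -/

noncomputable section

namespace SkewGaussian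

/-! ### The multivariate normal density: total mass, positivity, bounds. -/

section Density

variable {ι κ : Type*} [Fintype ι] [DecidableEq ι] [Fintype κ] [DecidableEq κ]

theorem continuous_mvnPDF (S : Matrix ι ι ℝ) : Continuous (mvnPDF S) := by
  unfold mvnPDF
  fun_prop

@[fun_prop]
theorem measurable_mvnPDF (S : Matrix ι ι ℝ) : Measurable (mvnPDF S) :=
  (continuous_mvnPDF S).measurable

theorem measurable_ofReal_mvnPDF (S : Matrix ι ι ℝ) :
    Measurable fun v => ENNReal.ofReal (mvnPDF S v) :=
  (measurable_mvnPDF S).ennreal_ofReal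

theorem mvnPDF_nonneg (S : Matrix ι ι ℝ) (v : ι → ℝ) : 0 ≤ mvnPDF S v := by
  unfold mvnPDF
  positivity

theorem mvnPDF_pos {S : Matrix ι ι ℝ} (hS : S.PosDef) (v : ι → ℝ) : 0 < mvnPDF S v := by
  have := hS.det_pos
  unfold mvnPDF
  positivity

theorem mvnPDF_le {S : Matrix ι ι ℝ} (hS : S.PosDef) (v : ι → ℝ) :
    mvnPDF S v ≤ (√((2 * Real.pi) ^ Fintype.card ι * S.det))⁻¹ := by
  have h : 0 ≤ v ⬝ᵥ (S⁻¹ *ᵥ v) := by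
    simpa using hS.inv.posSemidef.dotProduct_mulVec_nonneg v
  unfold mvnPDF
  exact mul_le_of_le_one_right (by positivity) (Real.exp_le_one_iff.2 (by linarith))

theorem mvnPDF_submatrix_equiv (S : Matrix ι ι ℝ) (e : κ ≃ ι) (v : ι → ℝ) :
    mvnPDF (S.submatrix e e) (v ∘ e) = mvnPDF S v := by
  unfold mvnPDF
  rw [Matrix.inv_submatrix_equiv, Matrix.det_submatrix_equiv_self, Matrix.submatrix_mulVec_equiv,
    Fintype.card_congr e, Function.comp_assoc, e.self_comp_symm, Function.comp_id,
    comp_equiv_dotProduct_comp_equiv]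

omit [DecidableEq ι] in
theorem lintegral_exp_neg_dotProduct_self :
    ∫⁻ v : ι → ℝ, ENNReal.ofReal (Real.exp (-(v ⬝ᵥ v) / 2)) =
      ENNReal.ofReal (√((2 * Real.pi) ^ Fintype.card ι)) := by
  have h (v : ι → ℝ) : Real.exp (-(v ⬝ᵥ v) / 2) = ∏ i, Real.exp (-(1 / 2) * v i ^ 2) := by
    rw [← Real.exp_sum, ← Finset.mul_sum, dotProduct]
    congr 1
    simp_rw [sq]
    ring
  have hi : Integrable fun x : ℝ => Real.exp (-(1 / 2) * x ^ 2) :=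
    integrable_exp_neg_mul_sq (by norm_num)
  simp_rw [h]
  have hi' : Integrable fun v : ι → ℝ => ∏ i, Real.exp (-(1 / 2) * v i ^ 2) :=
    Integrable.fintype_prod fun _ => hi
  rw [← ofReal_integral_eq_lintegral_ofReal hi' (ae_of_all _ fun v => by positivity),
    integral_fintype_prod_volume_eq_pow (fun x : ℝ => Real.exp (-(1 / 2) * x ^ 2)),
    integral_gaussian]
  congr 1
  symm
  rw [Real.sqrt_eq_iff_eq_sq (by positivity) (by positivity), pow_right_comm,
    Real.sq_sqrt (by positivity)]
  congr 1
  ring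

/-- Factoring `S⁻¹ = Uᵀ U` turns the quadratic form into `|U v|²`; the substitution `U v` has
Jacobian `|det U| = (det S)^(-1/2)`, leaving a product of one-dimensional Gaussian integrals. -/
theorem lintegral_mvnPDF {S : Matrix ι ι ℝ} (hS : S.PosDef) :
    ∫⁻ v, ENNReal.ofReal (mvnPDF S v) = 1 := by
  obtain ⟨U, hU, hSU⟩ : ∃ U : Matrix ι ι ℝ, IsUnit U ∧ S⁻¹ = star U * U := by
    open scoped MatrixOrder Matrix.Norms.L2Operator in
    exact CStarAlgebra.isStrictlyPositive_iff_eq_star_mul_self.mp hS.inv.isStrictlyPositive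
  rw [Matrix.star_eq_conjTranspose, Matrix.conjTranspose_eq_transpose_of_trivial] at hSU
  have hdet : U.det ≠ 0 := (U.isUnit_iff_isUnit_det.1 hU).ne_zero
  have hd : S.det = (U.det ^ 2)⁻¹ := by
    have h := congrArg Matrix.det hSU
    rw [Matrix.det_nonsing_inv, Matrix.det_mul, Matrix.det_transpose, Ring.inverse_eq_inv'] at h
    rw [sq, ← h, inv_inv]
  have hq (v : ι → ℝ) : v ⬝ᵥ (S⁻¹ *ᵥ v) = (U *ᵥ v) ⬝ᵥ (U *ᵥ v) := by
    rw [hSU, ← Matrix.mulVec_mulVec, Matrix.dotProduct_mulVec, Matrix.vecMul_transpose]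
  have hm : Measurable fun v : ι → ℝ => ENNReal.ofReal (Real.exp (-(v ⬝ᵥ v) / 2)) := by
    have : Continuous fun v : ι → ℝ => Real.exp (-(v ⬝ᵥ v) / 2) := by fun_prop
    exact this.measurable.ennreal_ofReal
  have hml : Measurable (Matrix.toLin' U) :=
    (LinearMap.continuous_of_finiteDimensional _).measurable
  have key := lintegral_map hm hml (μ := volume)
  rw [Real.map_matrix_volume_pi_eq_smul_volume_pi hdet, lintegral_smul_measure,
    lintegral_exp_neg_dotProduct_self] at key
  simp_rw [mvnPDF, hq, ENNReal.ofReal_mul (inv_nonneg.2 (Real.sqrt_nonneg _))]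
  rw [lintegral_const_mul _ (by
    have : Continuous fun v : ι → ℝ => Real.exp (-((U *ᵥ v) ⬝ᵥ (U *ᵥ v)) / 2) := by fun_prop
    exact this.measurable.ennreal_ofReal)]
  simp only [Matrix.toLin'_apply] at key
  rw [← key, smul_eq_mul, ← ENNReal.ofReal_mul (by positivity),
    ← ENNReal.ofReal_mul (by positivity), ENNReal.ofReal_eq_one, hd, Real.sqrt_mul (by positivity),
    Real.sqrt_inv, Real.sqrt_sq_eq_abs, abs_inv]
  have : |U.det| ≠ 0 := abs_ne_zero.2 hdet
  have : √((2 * Real.pi) ^ Fintype.card ι) ≠ 0 := by positivity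
  field_simp

theorem integrable_mvnPDF {S : Matrix ι ι ℝ} (hS : S.PosDef) : Integrable (mvnPDF S) := by
  refine ⟨(continuous_mvnPDF S).aestronglyMeasurable, ?_⟩
  rw [hasFiniteIntegral_iff_ofReal (ae_of_all _ (mvnPDF_nonneg S)), lintegral_mvnPDF hS]
  exact ENNReal.one_lt_top

theorem ofReal_mvnCDF {S : Matrix ι ι ℝ} (hS : S.PosDef) (a : ι → ℝ) :
    ENNReal.ofReal (mvnCDF S a) = ∫⁻ t in Set.Iic a, ENNReal.ofReal (mvnPDF S t) :=
  ofReal_integral_eq_lintegral_ofReal (integrable_mvnPDF hS).integrableOn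
    (ae_of_all _ (mvnPDF_nonneg S))

/-- The density is positive everywhere and the orthant has positive volume. -/
theorem mvnCDF_pos {S : Matrix ι ι ℝ} (hS : S.PosDef) (a : ι → ℝ) : 0 < mvnCDF S a := by
  rw [mvnCDF, setIntegral_pos_iff_support_of_nonneg_ae (ae_of_all _ (mvnPDF_nonneg S))
    (integrable_mvnPDF hS).integrableOn]
  have h : Function.support (mvnPDF S) = Set.univ :=
    Set.eq_univ_of_forall fun v => (mvnPDF_pos hS v).ne'
  rw [h, Set.univ_inter, ← Set.pi_univ_Iic, volume_pi_pi]
  simp [Real.volume_Iic, pos_iff_ne_zero]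

end Density

/-! ### Block covariance matrices and Schur complements. -/

section Blocks

variable {ι σ : Type*} {A : Matrix σ σ ℝ} {B : Matrix σ ι ℝ} {D : Matrix ι ι ℝ}

theorem posDef_lower_block (h : (Matrix.fromBlocks A B Bᵀ D).PosDef) : D.PosDef := by
  simpa using! h.submatrix (e := Sum.inr) Sum.inr_injective

theorem posDef_upper_block (h : (Matrix.fromBlocks A B Bᵀ D).PosDef) : A.PosDef := by
  simpa using! h.submatrix (e := Sum.inl) Sum.inl_injective

theorem fromBlocks_swap_eq_submatrix (A : Matrix σ σ ℝ) (B : Matrix σ ι ℝ) (D : Matrix ι ι ℝ) :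
    Matrix.fromBlocks D Bᵀ B A =
      (Matrix.fromBlocks A B Bᵀ D).submatrix (Equiv.sumComm ι σ) (Equiv.sumComm ι σ) := by
  ext (i | i) (j | j) <;> rfl

theorem posDef_fromBlocks_swap (h : (Matrix.fromBlocks A B Bᵀ D).PosDef) :
    (Matrix.fromBlocks D Bᵀ B A).PosDef := by
  rw [fromBlocks_swap_eq_submatrix]
  exact h.submatrix (Equiv.injective _)

variable [Fintype ι] [DecidableEq ι] [Fintype σ] [DecidableEq σ]

theorem det_fromBlocks_of_posDef (A : Matrix σ σ ℝ) (B : Matrix σ ι ℝ) (hD : D.PosDef) :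
    (Matrix.fromBlocks A B Bᵀ D).det = D.det * (A - B * D⁻¹ * Bᵀ).det := by
  let _ := hD.isUnit.invertible
  rw [Matrix.det_fromBlocks₂₂, Matrix.invOf_eq_nonsing_inv]

/-- The Schur criterion for semidefiniteness is upgraded by determinants: a semidefinite matrix is
definite iff its determinant is nonzero, and the block determinant is `det D` times that of the
complement. -/
theorem posDef_fromBlocks_iff (hD : D.PosDef) :
    (Matrix.fromBlocks A B Bᵀ D).PosDef ↔ (A - B * D⁻¹ * Bᵀ).PosDef := by
  let _ := hD.isUnit.invertible
  have hdet := det_fromBlocks_of_posDef A B hD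
  have hs : (Matrix.fromBlocks A B Bᵀ D).PosSemidef ↔ (A - B * D⁻¹ * Bᵀ).PosSemidef := by
    simpa using Matrix.PosDef.fromBlocks₂₂ A B hD
  constructor
  · intro h
    rw [(hs.1 h.posSemidef).posDef_iff_det_ne_zero]
    intro h0
    exact h.det_pos.ne' (by rw [hdet, h0, mul_zero])
  · intro h
    rw [(hs.2 h.posSemidef).posDef_iff_det_ne_zero, hdet]
    exact mul_ne_zero hD.det_pos.ne' h.det_pos.ne'

/-- Joint density = marginal density of `z` times conditional density of `t` given `z`. -/
theorem mvnPDF_fromBlocks (h : (Matrix.fromBlocks A B Bᵀ D).PosDef) (t : σ → ℝ) (z : ι → ℝ) :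
    mvnPDF (Matrix.fromBlocks A B Bᵀ D) (Sum.elim t z) =
      mvnPDF D z * mvnPDF (A - B * D⁻¹ * Bᵀ) (t - (B * D⁻¹) *ᵥ z) := by
  have hD := posDef_lower_block h
  have hS := (posDef_fromBlocks_iff hD).1 h
  have hDu := (Matrix.isUnit_iff_isUnit_det _).1 hD.isUnit
  have hSu := (Matrix.isUnit_iff_isUnit_det _).1 hS.isUnit
  have hMu := (Matrix.isUnit_iff_isUnit_det _).1 h.isUnit
  have hDt : D⁻¹ᵀ = D⁻¹ := by simpa using hD.inv.isHermitian.eq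
  set S := A - B * D⁻¹ * Bᵀ with hSdef
  set u := t - (B * D⁻¹) *ᵥ z with hu
  have ht : t = u + (B * D⁻¹) *ᵥ z := by rw [hu, sub_add_cancel]
  have hA : A = S + B * D⁻¹ * Bᵀ := by rw [hSdef, sub_add_cancel]
  -- `q` solves `M q = (t, z)` by block elimination, so the inverse block matrix is never written
  -- out.
  set q : σ ⊕ ι → ℝ := Sum.elim (S⁻¹ *ᵥ u) (D⁻¹ *ᵥ z - (D⁻¹ * Bᵀ) *ᵥ (S⁻¹ *ᵥ u)) with hq
  have hMq : Matrix.fromBlocks A B Bᵀ D *ᵥ q = Sum.elim t z := by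
    rw [hq, Matrix.fromBlocks_mulVec, Sum.elim_comp_inl, Sum.elim_comp_inr, ht, hA]
    congr 1
    · simp only [Matrix.add_mulVec, Matrix.add_mul, Matrix.mulVec_sub, Matrix.mulVec_mulVec,
        Matrix.mul_nonsing_inv _ hSu, Matrix.one_mulVec, Matrix.mul_assoc]
      abel
    · simp only [Matrix.mulVec_sub, Matrix.mulVec_mulVec, ← Matrix.mul_assoc,
        Matrix.mul_nonsing_inv _ hDu, Matrix.one_mulVec, Matrix.one_mul]
      abel
  have hinv : (Matrix.fromBlocks A B Bᵀ D)⁻¹ *ᵥ Sum.elim t z = q := by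
    rw [← hMq, Matrix.mulVec_mulVec, Matrix.nonsing_inv_mul _ hMu, Matrix.one_mulVec]
  have hquad : Sum.elim t z ⬝ᵥ ((Matrix.fromBlocks A B Bᵀ D)⁻¹ *ᵥ Sum.elim t z) =
      z ⬝ᵥ (D⁻¹ *ᵥ z) + u ⬝ᵥ (S⁻¹ *ᵥ u) := by
    have h1 : z ⬝ᵥ ((D⁻¹ * Bᵀ) *ᵥ (S⁻¹ *ᵥ u)) = ((B * D⁻¹) *ᵥ z) ⬝ᵥ (S⁻¹ *ᵥ u) := by
      rw [Matrix.dotProduct_mulVec, ← Matrix.mulVec_transpose, Matrix.transpose_mul, hDt,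
        Matrix.transpose_transpose]
    rw [hinv, hq, sumElim_dotProduct_sumElim, dotProduct_sub, h1, ht, add_dotProduct]
    ring
  have hdet := det_fromBlocks_of_posDef A B hD
  have hpos := hD.det_pos
  have hpos' := hS.det_pos
  unfold mvnPDF
  rw [hquad, hdet, ← hSdef, mul_mul_mul_comm, ← Real.exp_add, ← mul_inv,
    ← Real.sqrt_mul (by positivity), Fintype.card_sum, pow_add]
  congr 3
  · ring
  · ring

theorem mvnPDF_fromBlocks' (h : (Matrix.fromBlocks A B Bᵀ D).PosDef) (t : σ → ℝ) (z : ι → ℝ) :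
    mvnPDF (Matrix.fromBlocks A B Bᵀ D) (Sum.elim t z) =
      mvnPDF A t * mvnPDF (D - Bᵀ * A⁻¹ * B) (z - (Bᵀ * A⁻¹) *ᵥ t) := by
  have h' := posDef_fromBlocks_swap h
  have := mvnPDF_fromBlocks (A := D) (B := Bᵀ) (D := A) (by simpa using h') z t
  rw [Matrix.transpose_transpose] at this
  rw [← this, fromBlocks_swap_eq_submatrix,
    ← mvnPDF_submatrix_equiv (Matrix.fromBlocks A B Bᵀ D) (Equiv.sumComm ι σ)]
  congr 1
  ext (i | i) <;> rfl

end Blocks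

/-! ### Normal laws as measures, and their marginals. -/

section Law

variable {ι κ σ : Type*} [Fintype ι] [DecidableEq ι] [Fintype κ] [DecidableEq κ]
  [Fintype σ] [DecidableEq σ]

/-- The centred normal law with covariance `S`, as a measure with density. -/
def gaussianLaw (S : Matrix ι ι ℝ) : Measure (ι → ℝ) :=
  volume.withDensity fun v => ENNReal.ofReal (mvnPDF S v)

theorem lintegral_gaussianLaw (S : Matrix ι ι ℝ) {g : (ι → ℝ) → ℝ≥0∞} (hg : Measurable g) :
    ∫⁻ v, g v ∂gaussianLaw S = ∫⁻ v, ENNReal.ofReal (mvnPDF S v) * g v := by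
  rw [gaussianLaw, lintegral_withDensity_eq_lintegral_mul _ (measurable_ofReal_mvnPDF S) hg]
  rfl

theorem lintegral_map_gaussianLaw {α : Type*} [MeasurableSpace α] (S : Matrix ι ι ℝ)
    {f : (ι → ℝ) → α} (hf : Measurable f) {g : α → ℝ≥0∞} (hg : Measurable g) :
    ∫⁻ v, g v ∂(gaussianLaw S).map f = ∫⁻ v, ENNReal.ofReal (mvnPDF S v) * g (f v) := by
  rw [lintegral_map hg hf]
  exact lintegral_gaussianLaw S (hg.comp hf)

theorem measurable_comp_left {ι κ : Type*} (e : κ → ι) :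
    Measurable fun w : ι → ℝ => w ∘ e :=
  measurable_pi_lambda _ fun i => measurable_pi_apply (e i)

omit [DecidableEq ι] [DecidableEq σ] in
theorem lintegral_sumElim {f : (σ ⊕ ι → ℝ) → ℝ≥0∞} (hf : Measurable f) :
    ∫⁻ w, f w = ∫⁻ z : ι → ℝ, ∫⁻ t : σ → ℝ, f (Sum.elim t z) := by
  have h := volume_measurePreserving_sumPiEquivProdPi_symm (fun _ : σ ⊕ ι => ℝ)
  rw [← h.lintegral_comp hf, Measure.volume_eq_prod, lintegral_prod_symm]
  · refine lintegral_congr fun z => lintegral_congr fun t => ?_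
    rfl
  · exact (hf.comp h.measurable).aemeasurable

theorem gaussianLaw_map_equiv (M : Matrix ι ι ℝ) (e : κ ≃ ι) :
    (gaussianLaw M).map (fun w => w ∘ e) = gaussianLaw (M.submatrix e e) := by
  have h := volume_measurePreserving_piCongrLeft (fun _ : κ => ℝ) e.symm
  have he (w : ι → ℝ) : MeasurableEquiv.piCongrLeft (fun _ : κ => ℝ) e.symm w = w ∘ e := by
    ext i
    obtain ⟨j, rfl⟩ := e.symm.surjective i
    rw [MeasurableEquiv.coe_piCongrLeft, Equiv.piCongrLeft_apply_apply]
    simp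
  refine Measure.ext_of_lintegral _ fun g hg => ?_
  rw [lintegral_map_gaussianLaw _ (measurable_comp_left e) hg, lintegral_gaussianLaw _ hg,
    ← h.lintegral_comp (by fun_prop)]
  simp_rw [he, mvnPDF_submatrix_equiv]

omit [Fintype ι] [DecidableEq ι] [Fintype σ] [DecidableEq σ] in
theorem exists_eq_fromBlocks {M : Matrix (σ ⊕ ι) (σ ⊕ ι) ℝ} (hM : M.PosDef) :
    ∃ A B D, M = Matrix.fromBlocks A B Bᵀ D := by
  refine ⟨M.toBlocks₁₁, M.toBlocks₁₂, M.toBlocks₂₂, ?_⟩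
  have h := hM.isHermitian
  rw [← M.fromBlocks_toBlocks, Matrix.isHermitian_fromBlocks_iff] at h
  conv_lhs => rw [← M.fromBlocks_toBlocks, ← h.2.1]
  rfl

/-- In the marginal-times-conditional factorisation, the conditional density of `t` integrates to
one by translation invariance. -/
theorem gaussianLaw_map_inr {M : Matrix (σ ⊕ ι) (σ ⊕ ι) ℝ} (hM : M.PosDef) :
    (gaussianLaw M).map (fun w => w ∘ Sum.inr) = gaussianLaw (M.submatrix Sum.inr Sum.inr) := by
  obtain ⟨A, B, D, rfl⟩ := exists_eq_fromBlocks hM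
  have hS := (posDef_fromBlocks_iff (posDef_lower_block hM)).1 hM
  refine Measure.ext_of_lintegral _ fun g hg => ?_
  rw [lintegral_map_gaussianLaw _ (measurable_comp_left _) hg, lintegral_gaussianLaw _ hg,
    lintegral_sumElim (by
      have : Measurable fun w : σ ⊕ ι → ℝ => w ∘ Sum.inr := measurable_comp_left _
      fun_prop)]
  refine lintegral_congr fun z => ?_
  simp only [mvnPDF_fromBlocks hM, Sum.elim_comp_inr, ENNReal.ofReal_mul (mvnPDF_nonneg _ _),
    mul_right_comm _ _ (g z)]
  rw [lintegral_const_mul _ (by fun_prop),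
    lintegral_sub_right_eq_self (fun t => ENNReal.ofReal (mvnPDF (A - B * D⁻¹ * Bᵀ) t)),
    lintegral_mvnPDF hS, mul_one]
  rfl

theorem gaussianLaw_map_comp {M : Matrix ι ι ℝ} (hM : M.PosDef) {e : κ → ι}
    (he : Function.Injective e) :
    (gaussianLaw M).map (fun w => w ∘ e) = gaussianLaw (M.submatrix e e) := by
  classical
  -- Coordinates outside the range of `e` form the left block, to be integrated out.
  let f : {i // i ∉ Set.range e} ⊕ κ ≃ ι := Equiv.ofBijective (Sum.elim Subtype.val e) (by
    refine ⟨Subtype.val_injective.sumElim he fun i k h => i.2 ⟨k, h.symm⟩, fun i => ?_⟩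
    by_cases hi : i ∈ Set.range e
    · obtain ⟨k, rfl⟩ := hi
      exact ⟨Sum.inr k, rfl⟩
    · exact ⟨Sum.inl ⟨i, hi⟩, rfl⟩)
  have h : (gaussianLaw M).map (fun w => w ∘ e) =
      ((gaussianLaw M).map (fun w => w ∘ f)).map (fun w => w ∘ Sum.inr) := by
    rw [Measure.map_map (measurable_comp_left _) (measurable_comp_left _)]
    rfl
  rw [h, gaussianLaw_map_equiv, gaussianLaw_map_inr (hM.submatrix f.injective)]
  rfl

end Law

/-! ### Gaussian conjugacy for a linear observation with normal noise. -/

section Conjugacy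

variable {ι η ν : Type*} [Fintype ι] [DecidableEq ι] [Fintype η] [DecidableEq η] [Fintype ν]

/-- The covariance of `C (w ∘ b) + ε` when `w` and the noise `ε` have covariances `M` and `R`. -/
def obsCov (M : Matrix ι ι ℝ) (b : ν → ι) (C : Matrix η ν ℝ) (R : Matrix η η ℝ) : Matrix η η ℝ :=
  C * M.submatrix b b * Cᵀ + R

/-- The covariance of `C (w ∘ b)` and `w` when `w` has covariance `M`. -/
def obsCross (M : Matrix ι ι ℝ) (b : ν → ι) (C : Matrix η ν ℝ) : Matrix η ι ℝ :=
  C * M.submatrix b id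

/-- The conditional covariance of `w` given `C (w ∘ b) + ε`. -/
def condCov (M : Matrix ι ι ℝ) (b : ν → ι) (C : Matrix η ν ℝ) (R : Matrix η η ℝ) : Matrix ι ι ℝ :=
  M - (obsCross M b C)ᵀ * (obsCov M b C R)⁻¹ * obsCross M b C

omit [Fintype ι] [DecidableEq ι] [Fintype η] [DecidableEq η] in
theorem obsCross_submatrix {α : Type*} (M : Matrix ι ι ℝ) (b : ν → ι) (C : Matrix η ν ℝ)
    (e : α → ι) : (obsCross M b C).submatrix id e = C * M.submatrix b e :=
  rfl

omit [Fintype ι] [DecidableEq ι] in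
theorem condCov_submatrix {α β : Type*} (M : Matrix ι ι ℝ) (b : ν → ι) (C : Matrix η ν ℝ)
    (R : Matrix η η ℝ) (e : α → ι) (f : β → ι) :
    (condCov M b C R).submatrix e f = M.submatrix e f - ((obsCross M b C).submatrix id e)ᵀ *
      (obsCov M b C R)⁻¹ * (obsCross M b C).submatrix id f :=
  rfl

variable {M : Matrix ι ι ℝ} {R : Matrix η η ℝ}

omit [Fintype η] [DecidableEq η] in
theorem obsCross_mul_inv (hM : M.PosDef) (b : ν → ι) (C : Matrix η ν ℝ) :
    obsCross M b C * M⁻¹ = C * (1 : Matrix ι ι ℝ).submatrix b id := by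
  rw [obsCross, Matrix.mul_assoc,
    ← Matrix.mul_nonsing_inv M ((Matrix.isUnit_iff_isUnit_det _).1 hM.isUnit),
    Matrix.submatrix_mul _ _ b id id Function.bijective_id, Matrix.submatrix_id_id M⁻¹]

-- The conditional covariance of `C (w ∘ b) + ε` given `w` is that of the noise alone. Definiteness
-- of the joint covariance thus needs no rank condition on `C` and no injectivity of `b`.
omit [Fintype η] [DecidableEq η] in
theorem obsCov_sub (hM : M.PosDef) (R : Matrix η η ℝ) (b : ν → ι) (C : Matrix η ν ℝ) :
    obsCov M b C R - obsCross M b C * M⁻¹ * (obsCross M b C)ᵀ = R := by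
  have hMt : Mᵀ = M := by simpa using hM.isHermitian.eq
  have h : (1 : Matrix ι ι ℝ).submatrix b id * (M.submatrix b id)ᵀ = M.submatrix b b := by
    rw [Matrix.transpose_submatrix, hMt, ← Matrix.submatrix_mul _ _ b id b Function.bijective_id,
      Matrix.one_mul]
  rw [obsCross_mul_inv hM, obsCov, obsCross, Matrix.transpose_mul,
    Matrix.mul_assoc C _ (_ * _), ← Matrix.mul_assoc _ _ Cᵀ, h, ← Matrix.mul_assoc C, add_sub_cancel_left]

theorem posDef_fromBlocks_obs (hM : M.PosDef) (hR : R.PosDef) (b : ν → ι) (C : Matrix η ν ℝ) :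
    (Matrix.fromBlocks (obsCov M b C R) (obsCross M b C) (obsCross M b C)ᵀ M).PosDef := by
  rw [posDef_fromBlocks_iff hM, obsCov_sub hM]
  exact hR

theorem posDef_condCov (hM : M.PosDef) (hR : R.PosDef) (b : ν → ι) (C : Matrix η ν ℝ) :
    (condCov M b C R).PosDef := by
  have h := posDef_fromBlocks_obs hM hR b C
  have h' := (posDef_fromBlocks_iff (B := (obsCross M b C)ᵀ) (posDef_upper_block h)).1
    (by simpa using posDef_fromBlocks_swap h)
  simpa [condCov] using h'

/-- Both sides are the joint density of `(C (w ∘ b) + ε, w)` at `(y, w)`, factored by conditioning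
in the two possible orders. -/
theorem mvnPDF_mul_mvnPDF (hM : M.PosDef) (hR : R.PosDef) (b : ν → ι) (C : Matrix η ν ℝ)
    (y : η → ℝ) (w : ι → ℝ) :
    mvnPDF M w * mvnPDF R (y - C *ᵥ (w ∘ b)) =
      mvnPDF (obsCov M b C R) y *
        mvnPDF (condCov M b C R) (w - ((obsCross M b C)ᵀ * (obsCov M b C R)⁻¹) *ᵥ y) := by
  have h := posDef_fromBlocks_obs hM hR b C
  have h1 := mvnPDF_fromBlocks h y w
  have h2 : (1 : Matrix ι ι ℝ).submatrix b id *ᵥ w = w ∘ b := by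
    ext i
    simp [Matrix.mulVec, dotProduct, Matrix.one_apply]
  rw [obsCov_sub hM, obsCross_mul_inv hM, ← Matrix.mulVec_mulVec, h2] at h1
  rw [← h1, mvnPDF_fromBlocks' h, condCov]

theorem gaussianLaw_withDensity (hM : M.PosDef) (hR : R.PosDef) (b : ν → ι) (C : Matrix η ν ℝ)
    (y : η → ℝ) :
    (gaussianLaw M).withDensity (fun w => ENNReal.ofReal (mvnPDF R (y - C *ᵥ (w ∘ b)))) =
      ENNReal.ofReal (mvnPDF (obsCov M b C R) y) •
        (gaussianLaw (condCov M b C R)).map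
          (fun w => w + ((obsCross M b C)ᵀ * (obsCov M b C R)⁻¹) *ᵥ y) := by
  set a := ((obsCross M b C)ᵀ * (obsCov M b C R)⁻¹) *ᵥ y with ha
  have hadd : Measurable fun w : ι → ℝ => w + a := measurable_id.add_const a
  have hd : Measurable fun w : ι → ℝ => ENNReal.ofReal (mvnPDF R (y - C *ᵥ (w ∘ b))) := by
    have : Continuous fun w : ι → ℝ => y - C *ᵥ (w ∘ b) := by
      have : Continuous fun w : ι → ℝ => w ∘ b := by fun_prop
      fun_prop
    exact (measurable_ofReal_mvnPDF R).comp this.measurable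
  refine Measure.ext_of_lintegral _ fun g hg => ?_
  rw [lintegral_withDensity_eq_lintegral_mul _ hd hg, lintegral_gaussianLaw _ (hd.mul hg),
    lintegral_smul_measure, lintegral_map_gaussianLaw _ hadd hg,
    smul_eq_mul, ← lintegral_const_mul _ (by fun_prop)]
  refine Eq.trans (lintegral_congr fun w => ?_) (lintegral_sub_right_eq_self _ a)
  simp only [Pi.mul_apply, sub_add_cancel]
  rw [← mul_assoc, ← mul_assoc, ← ENNReal.ofReal_mul (mvnPDF_nonneg _ _),
    ← ENNReal.ofReal_mul (mvnPDF_nonneg _ _), mvnPDF_mul_mvnPDF hM hR]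

end Conjugacy

/-! ### Normal laws restricted to `t ≤ γ`. -/

section Selection

variable {ι κ σ : Type*} [Fintype ι] [DecidableEq ι] [Fintype κ] [DecidableEq κ]
  [Fintype σ] [DecidableEq σ]

/-- The law of `ξ + z` for a centred normal vector `(t, z)` with covariance `M`, restricted to the
event `t ≤ γ`. Its total mass is the probability of that event. -/
def selectionLaw (M : Matrix (σ ⊕ ι) (σ ⊕ ι) ℝ) (γ : σ → ℝ) (ξ : ι → ℝ) : Measure (ι → ℝ) :=
  ((gaussianLaw M).restrict {w | w ∘ Sum.inl ≤ γ}).map fun w => w ∘ Sum.inr + ξ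

omit [Fintype ι] [DecidableEq ι] [DecidableEq σ] in
theorem measurableSet_comp_inl_le (γ : σ → ℝ) :
    MeasurableSet {w : σ ⊕ ι → ℝ | w ∘ Sum.inl ≤ γ} :=
  measurable_comp_left Sum.inl measurableSet_Iic

omit [Fintype ι] [DecidableEq ι] [Fintype σ] [DecidableEq σ] in
theorem measurable_comp_inr_add (ξ : ι → ℝ) :
    Measurable fun w : σ ⊕ ι → ℝ => w ∘ Sum.inr + ξ :=
  (measurable_comp_left Sum.inr).add_const ξ

theorem selectionLaw_univ {M : Matrix (σ ⊕ ι) (σ ⊕ ι) ℝ} (hM : M.PosDef) (γ : σ → ℝ)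
    (ξ : ι → ℝ) :
    selectionLaw M γ ξ Set.univ =
      ENNReal.ofReal (mvnCDF (M.submatrix Sum.inl Sum.inl) γ) := by
  rw [selectionLaw, Measure.map_apply (measurable_comp_inr_add ξ) MeasurableSet.univ,
    Set.preimage_univ, Measure.restrict_apply_univ,
    ofReal_mvnCDF (hM.submatrix Sum.inl_injective), ← withDensity_apply _ measurableSet_Iic]
  change _ = gaussianLaw _ _
  rw [← gaussianLaw_map_comp hM Sum.inl_injective,
    Measure.map_apply (measurable_comp_left _) measurableSet_Iic]
  rfl

/-- Marginalising touches only the `z`-coordinates, so it commutes with the restriction on `t`. -/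
theorem selectionLaw_map_comp {M : Matrix (σ ⊕ ι) (σ ⊕ ι) ℝ} (hM : M.PosDef) (γ : σ → ℝ)
    (ξ : ι → ℝ) {a : κ → ι} (ha : Function.Injective a) :
    (selectionLaw M γ ξ).map (fun z => z ∘ a) =
      selectionLaw (M.submatrix (Sum.map id a) (Sum.map id a)) γ (ξ ∘ a) := by
  rw [selectionLaw, Measure.map_map (measurable_comp_left a) (measurable_comp_inr_add ξ),
    selectionLaw, ← gaussianLaw_map_comp hM (Function.injective_id.sumMap ha),
    Measure.restrict_map (measurable_comp_left _) (measurableSet_comp_inl_le γ),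
    Measure.map_map (measurable_comp_inr_add _) (measurable_comp_left _)]
  rfl

theorem withDensity_map {α β : Type*} [MeasurableSpace α] [MeasurableSpace β] (μ : Measure α)
    {f : α → β} (hf : Measurable f) {h : β → ℝ≥0∞} (hh : Measurable h) :
    (μ.map f).withDensity h = (μ.withDensity fun a => h (f a)).map f := by
  refine Measure.ext_of_lintegral _ fun g hg => ?_
  rw [lintegral_withDensity_eq_lintegral_mul _ hh hg, lintegral_map (hh.mul hg) hf,
    lintegral_map hg hf]
  exact (lintegral_withDensity_eq_lintegral_mul _ (hh.comp hf) (hg.comp hf)).symm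

/-- Conjugacy on the full vector `(t, z)`, observed through `z` alone. The posterior mean `u` is
absorbed by both parameters: `t + u ≤ γ` becomes a new threshold, and `z + u` a new location. -/
theorem selectionLaw_withDensity {η ν : Type*} [Fintype η] [DecidableEq η] [Fintype ν]
    {M : Matrix (σ ⊕ ι) (σ ⊕ ι) ℝ} (hM : M.PosDef) {R : Matrix η η ℝ} (hR : R.PosDef)
    (γ : σ → ℝ) (ξ : ι → ℝ) (b : ν → ι) (C : Matrix η ν ℝ) (y : η → ℝ)
    {u : σ ⊕ ι → ℝ} (hu : u = ((obsCross M (Sum.inr ∘ b) C)ᵀ *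
      (obsCov M (Sum.inr ∘ b) C R)⁻¹) *ᵥ (y - C *ᵥ (ξ ∘ b))) :
    (selectionLaw M γ ξ).withDensity
        (fun z => ENNReal.ofReal (mvnPDF R (y - C *ᵥ (z ∘ b)))) =
      ENNReal.ofReal (mvnPDF (obsCov M (Sum.inr ∘ b) C R) (y - C *ᵥ (ξ ∘ b))) •
        selectionLaw (condCov M (Sum.inr ∘ b) C R) (γ - u ∘ Sum.inl) (ξ + u ∘ Sum.inr) := by
  have hh : Measurable fun z : ι → ℝ => ENNReal.ofReal (mvnPDF R (y - C *ᵥ (z ∘ b))) := by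
    have : Continuous fun z : ι → ℝ => y - C *ᵥ (z ∘ b) := by
      have : Continuous fun z : ι → ℝ => z ∘ b := by fun_prop
      fun_prop
    exact (measurable_ofReal_mvnPDF R).comp this.measurable
  have hadd : Measurable fun w : σ ⊕ ι → ℝ => w + u := measurable_id.add_const u
  have h (w : σ ⊕ ι → ℝ) : y - C *ᵥ ((w ∘ Sum.inr + ξ) ∘ b) =
      (y - C *ᵥ (ξ ∘ b)) - C *ᵥ (w ∘ (Sum.inr ∘ b)) := by
    have : (w ∘ Sum.inr + ξ) ∘ b = w ∘ (Sum.inr ∘ b) + ξ ∘ b := rfl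
    rw [this, Matrix.mulVec_add]
    abel
  rw [selectionLaw, withDensity_map _ (measurable_comp_inr_add ξ) hh,
    ← restrict_withDensity (measurableSet_comp_inl_le γ)]
  simp_rw [h]
  rw [gaussianLaw_withDensity hM hR, ← hu, Measure.restrict_smul, Measure.map_smul,
    Measure.restrict_map hadd (measurableSet_comp_inl_le γ),
    Measure.map_map (measurable_comp_inr_add _) hadd, selectionLaw]
  congr 3
  · funext w
    ext i
    simp only [Function.comp_apply, Pi.add_apply]
    ring
  · ext w
    simp only [Set.mem_preimage, Set.mem_ofPred_eq, le_sub_iff_add_le]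
    rfl

end Selection

/-! ### SUN laws as normalised selection laws. -/

section SunLaw

variable {ι σ : Type*} [Fintype ι] [DecidableEq ι] [Fintype σ] [DecidableEq σ]
  {Ω : Matrix ι ι ℝ} {Δ : Matrix ι σ ℝ} {Γ : Matrix σ σ ℝ}

/-- The covariance matrix of the normal vector `(t, z)` such that `z` conditioned on `t ≤ γ` has
the unified skew-normal distribution with parameters `0, Ω, Δ, γ, Γ`. -/
def sunCov (Ω : Matrix ι ι ℝ) (Δ : Matrix ι σ ℝ) (Γ : Matrix σ σ ℝ) :
    Matrix (σ ⊕ ι) (σ ⊕ ι) ℝ :=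
  Matrix.fromBlocks Γ (-(scaleDiag Ω * Δ)ᵀ) (-(scaleDiag Ω * Δ)) Ω

omit [Fintype ι] in
theorem transpose_scaleDiag (Ω : Matrix ι ι ℝ) : (scaleDiag Ω)ᵀ = scaleDiag Ω :=
  Matrix.diagonal_transpose _

theorem scaleDiag_mul_apply {κ : Type*} (Ω : Matrix ι ι ℝ) (A : Matrix ι κ ℝ) (i : ι) (k : κ) :
    (scaleDiag Ω * A) i k = √(Ω i i) * A i k :=
  Matrix.diagonal_mul _ _ i k

theorem isUnit_det_scaleDiag (h : ∀ i, 0 < Ω i i) : IsUnit (scaleDiag Ω).det := by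
  rw [scaleDiag, Matrix.det_diagonal, isUnit_iff_ne_zero, Finset.prod_ne_zero_iff]
  exact fun i _ => (Real.sqrt_pos.2 (h i)).ne'

theorem diag_pos_of_posDef_corr (h : (corr Ω).PosDef) (i : ι) : 0 < Ω i i := by
  by_contra! hi
  have h0 : ¬ IsUnit (scaleDiag Ω).det := by
    rw [scaleDiag, Matrix.det_diagonal, isUnit_iff_ne_zero, not_not]
    exact Finset.prod_eq_zero (Finset.mem_univ i) (Real.sqrt_eq_zero_of_nonpos hi)
  have := h.diag_pos (i := i)
  -- A nonpositive diagonal entry has `√` equal to `0`, so `scaleDiag Ω` is singular, its inverse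
  -- takes the default value `0`, and `corr Ω` vanishes.
  rw [corr, Matrix.nonsing_inv_apply_not_isUnit _ h0] at this
  simp at this

theorem scaleDiag_mul_corr_mul (h : ∀ i, 0 < Ω i i) :
    scaleDiag Ω * corr Ω * scaleDiag Ω = Ω := by
  have hD := isUnit_det_scaleDiag h
  rw [corr, Matrix.mul_assoc (scaleDiag Ω)⁻¹, Matrix.mul_nonsing_inv_cancel_left _ _ hD,
    Matrix.nonsing_inv_mul_cancel_right _ _ hD]

theorem corr_inv (h : ∀ i, 0 < Ω i i) :
    (corr Ω)⁻¹ = scaleDiag Ω * Ω⁻¹ * scaleDiag Ω := by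
  have hD := isUnit_det_scaleDiag h
  rw [corr, Matrix.mul_inv_rev, Matrix.mul_inv_rev, Matrix.nonsing_inv_nonsing_inv _ hD,
    Matrix.mul_assoc]

omit [Fintype σ] [DecidableEq σ] in
theorem diag_pos_of_posDef_sunMatrix (h : (sunMatrix Ω Δ Γ).PosDef) (i : ι) : 0 < Ω i i :=
  diag_pos_of_posDef_corr (posDef_lower_block (B := Δᵀ) (by simpa [sunMatrix] using h)) i

theorem posDef_sunMatrix_iff (h : ∀ i, 0 < Ω i i) :
    (sunMatrix Ω Δ Γ).PosDef ↔ (sunCov Ω Δ Γ).PosDef := by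
  have hD := isUnit_det_scaleDiag h
  -- Congruence by `U` rescales correlations to covariances and flips the sign of `t`.
  let U : Matrix (σ ⊕ ι) (σ ⊕ ι) ℝ := Matrix.fromBlocks (-1) 0 0 (scaleDiag Ω)
  have hU : IsUnit U := by
    rw [Matrix.isUnit_iff_isUnit_det, Matrix.det_fromBlocks_zero₂₁, Matrix.det_neg, Matrix.det_one]
    exact IsUnit.mul (by simp) hD
  have h1 : sunCov Ω Δ Γ = star U * sunMatrix Ω Δ Γ * U := by
    rw [Matrix.star_eq_conjTranspose, Matrix.conjTranspose_eq_transpose_of_trivial,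
      Matrix.fromBlocks_transpose, sunMatrix, Matrix.fromBlocks_multiply,
      Matrix.fromBlocks_multiply, sunCov]
    simp [transpose_scaleDiag, scaleDiag_mul_corr_mul h]
  rw [h1, Matrix.IsUnit.posDef_star_left_conjugate_iff hU]

theorem posDef_sunCov (h : (sunMatrix Ω Δ Γ).PosDef) : (sunCov Ω Δ Γ).PosDef :=
  (posDef_sunMatrix_iff (diag_pos_of_posDef_sunMatrix h)).1 h

omit [DecidableEq σ] in
theorem lintegral_Iic_add (γ c : σ → ℝ) (F : (σ → ℝ) → ℝ≥0∞) :
    ∫⁻ t in Set.Iic γ, F (t + c) = ∫⁻ t in Set.Iic (γ + c), F t := by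
  rw [← lintegral_indicator measurableSet_Iic, ← lintegral_indicator measurableSet_Iic]
  refine Eq.trans (lintegral_congr fun t => ?_) (lintegral_add_right_eq_self _ c)
  by_cases h : t ≤ γ <;> simp [h]

/-- Given `z`, `t` is normal with mean `-K z` and covariance `S`, so `t ≤ γ` has conditional
probability `Φ(γ + K z; S)`. The minus sign in `sunCov` is what gives `+K z` here. -/
theorem sun_eq_smul_selectionLaw (h : (sunMatrix Ω Δ Γ).PosDef) (ξ : ι → ℝ) (γ : σ → ℝ) :
    sun ξ Ω Δ γ Γ = (ENNReal.ofReal (mvnCDF Γ γ))⁻¹ • selectionLaw (sunCov Ω Δ Γ) γ ξ := by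
  have hpos := diag_pos_of_posDef_sunMatrix h
  have hD := isUnit_det_scaleDiag hpos
  have hM := posDef_sunCov h
  have hM' : (Matrix.fromBlocks Γ (-(scaleDiag Ω * Δ)ᵀ) (-(scaleDiag Ω * Δ)ᵀ)ᵀ Ω).PosDef := by
    simpa [sunCov] using hM
  have hcov : sunCov Ω Δ Γ =
      Matrix.fromBlocks Γ (-(scaleDiag Ω * Δ)ᵀ) (-(scaleDiag Ω * Δ)ᵀ)ᵀ Ω := by simp [sunCov]
  have hΓ := posDef_upper_block hM'
  have hS := (posDef_fromBlocks_iff (posDef_lower_block hM')).1 hM'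
  have hSe : Γ - -(scaleDiag Ω * Δ)ᵀ * Ω⁻¹ * (-(scaleDiag Ω * Δ)ᵀ)ᵀ =
      Γ - Δᵀ * (corr Ω)⁻¹ * Δ := by
    simp [corr_inv hpos, transpose_scaleDiag, Matrix.mul_assoc]
  have hce (z : ι → ℝ) : -((-(scaleDiag Ω * Δ)ᵀ * Ω⁻¹) *ᵥ z) =
      (Δᵀ * (corr Ω)⁻¹ * (scaleDiag Ω)⁻¹) *ᵥ z := by
    rw [corr_inv hpos, ← Matrix.mul_assoc, Matrix.mul_nonsing_inv_cancel_right _ _ hD]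
    simp [transpose_scaleDiag, Matrix.mul_assoc, Matrix.neg_mulVec]
  rw [hSe] at hS
  refine Measure.ext_of_lintegral _ fun g hg => ?_
  have hmA := measurableSet_comp_inl_le (ι := ι) γ
  set S := Γ - Δᵀ * (corr Ω)⁻¹ * Δ with hSdef
  set K := Δᵀ * (corr Ω)⁻¹ * (scaleDiag Ω)⁻¹
  have hsun (z : ι → ℝ) : ENNReal.ofReal (sunPDF ξ Ω Δ γ Γ (z + ξ)) =
      (ENNReal.ofReal (mvnCDF Γ γ))⁻¹ * (ENNReal.ofReal (mvnPDF Ω z) *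
        ∫⁻ t in Set.Iic γ, ENNReal.ofReal (mvnPDF S (t + K *ᵥ z))) := by
    rw [lintegral_Iic_add _ _ fun t => ENNReal.ofReal (mvnPDF S t), ← ofReal_mvnCDF hS, sunPDF,
      add_sub_cancel_right, ENNReal.ofReal_mul (mvnPDF_nonneg _ _),
      ENNReal.ofReal_div_of_pos (mvnCDF_pos hΓ γ), div_eq_mul_inv, ← mul_assoc, mul_comm]
  have hK : Continuous fun z : ι → ℝ => K *ᵥ z := by fun_prop
  -- With `z` moved from the limit of integration into the integrand, measurability of the skewing
  -- factor follows from Tonelli.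
  have hint : Measurable fun z : ι → ℝ =>
      ∫⁻ t in Set.Iic γ, ENNReal.ofReal (mvnPDF S (t + K *ᵥ z)) := by
    refine Measurable.lintegral_prod_right
      (f := fun z t => ENNReal.ofReal (mvnPDF S (t + K *ᵥ z))) ?_
    exact (measurable_ofReal_mvnPDF S).comp
      (measurable_snd.add (hK.measurable.comp measurable_fst))
  have hpdf : Measurable fun z => ENNReal.ofReal (sunPDF ξ Ω Δ γ Γ z) := by
    have : (fun z => ENNReal.ofReal (sunPDF ξ Ω Δ γ Γ z)) = fun z =>
        (ENNReal.ofReal (mvnCDF Γ γ))⁻¹ * (ENNReal.ofReal (mvnPDF Ω (z - ξ)) *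
          ∫⁻ t in Set.Iic γ, ENNReal.ofReal (mvnPDF S (t + K *ᵥ (z - ξ)))) := by
      funext z
      rw [← hsun, sub_add_cancel]
    rw [this]
    exact (((measurable_ofReal_mvnPDF Ω).mul hint).comp (measurable_id.sub_const ξ)).const_mul _
  have hφ := measurable_ofReal_mvnPDF (sunCov Ω Δ Γ)
  have hgξ : Measurable fun w : σ ⊕ ι → ℝ => g (w ∘ Sum.inr + ξ) :=
    hg.comp (measurable_comp_inr_add ξ)
  have hint' : Measurable fun z : ι → ℝ => ENNReal.ofReal (mvnPDF Ω z) * g (z + ξ) *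
      ∫⁻ t in Set.Iic γ, ENNReal.ofReal (mvnPDF S (t + K *ᵥ z)) :=
    ((measurable_ofReal_mvnPDF Ω).mul (hg.comp (measurable_id.add_const ξ))).mul hint
  have hinner (z : ι → ℝ) : ∫⁻ t : σ → ℝ, {w : σ ⊕ ι → ℝ | w ∘ Sum.inl ≤ γ}.indicator
        (fun w => ENNReal.ofReal (mvnPDF (sunCov Ω Δ Γ) w) * g (w ∘ Sum.inr + ξ)) (Sum.elim t z) =
      ENNReal.ofReal (mvnPDF Ω z) * g (z + ξ) *
        ∫⁻ t in Set.Iic γ, ENNReal.ofReal (mvnPDF S (t + K *ᵥ z)) := by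
    rw [← lintegral_const_mul _ (by fun_prop), ← lintegral_indicator measurableSet_Iic]
    refine lintegral_congr fun t => ?_
    have hfac : mvnPDF (sunCov Ω Δ Γ) (Sum.elim t z) =
        mvnPDF Ω z * mvnPDF S (t + K *ᵥ z) := by
      rw [hcov, mvnPDF_fromBlocks hM', hSe, sub_eq_add_neg, hce]
    by_cases ht : t ≤ γ
    · simp only [Set.indicator, Set.mem_ofPred_eq, Sum.elim_comp_inl, Sum.elim_comp_inr, ht,
        Set.mem_Iic, if_true, hfac, ENNReal.ofReal_mul (mvnPDF_nonneg _ _)]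
      ring
    · simp [Set.indicator, ht]
  calc ∫⁻ z, g z ∂sun ξ Ω Δ γ Γ
      = ∫⁻ z, ENNReal.ofReal (sunPDF ξ Ω Δ γ Γ z) * g z :=
        lintegral_withDensity_eq_lintegral_mul _ hpdf hg
    _ = ∫⁻ z, ENNReal.ofReal (sunPDF ξ Ω Δ γ Γ (z + ξ)) * g (z + ξ) :=
        (lintegral_add_right_eq_self (fun z => ENNReal.ofReal (sunPDF ξ Ω Δ γ Γ z) * g z) ξ).symm
    _ = ∫⁻ z, (ENNReal.ofReal (mvnCDF Γ γ))⁻¹ * (ENNReal.ofReal (mvnPDF Ω z) * g (z + ξ) *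
          ∫⁻ t in Set.Iic γ, ENNReal.ofReal (mvnPDF S (t + K *ᵥ z))) := by
        refine lintegral_congr fun z => ?_
        rw [hsun]
        ring
    _ = (ENNReal.ofReal (mvnCDF Γ γ))⁻¹ * ∫⁻ w in {w : σ ⊕ ι → ℝ | w ∘ Sum.inl ≤ γ},
          ENNReal.ofReal (mvnPDF (sunCov Ω Δ Γ) w) * g (w ∘ Sum.inr + ξ) := by
        rw [lintegral_const_mul _ hint', ← lintegral_indicator hmA,
          lintegral_sumElim (by exact (hφ.mul hgξ).indicator hmA)]
        simp_rw [← hinner]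
    _ = ∫⁻ z, g z ∂(ENNReal.ofReal (mvnCDF Γ γ))⁻¹ • selectionLaw (sunCov Ω Δ Γ) γ ξ := by
        rw [lintegral_smul_measure, selectionLaw, lintegral_map hg (measurable_comp_inr_add ξ),
          gaussianLaw, restrict_withDensity hmA, lintegral_withDensity_eq_lintegral_mul _ hφ hgξ]
        rfl

theorem sun_univ (h : (sunMatrix Ω Δ Γ).PosDef) (ξ : ι → ℝ) (γ : σ → ℝ) :
    sun ξ Ω Δ γ Γ Set.univ = 1 := by
  have hM := posDef_sunCov h
  have hΓ : Γ.PosDef := hM.submatrix Sum.inl_injective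
  rw [sun_eq_smul_selectionLaw h, Measure.smul_apply, selectionLaw_univ hM]
  exact ENNReal.inv_mul_cancel (ENNReal.ofReal_pos.2 (mvnCDF_pos hΓ γ)).ne' ENNReal.ofReal_ne_top

end SunLaw

/-! ### Bayes' rule as a disintegration of the joint law. -/

section BayesRule

variable {Θ 𝒴 : Type*} [MeasurableSpace Θ] [MeasurableSpace 𝒴] {L : Θ → 𝒴 → ℝ≥0∞}

theorem isMarkovKernel_bayesPosterior (μ : Measure Θ) [SFinite μ]
    (hL : Measurable (Function.uncurry L)) (h0 : ∀ y, ∫⁻ θ, L θ y ∂μ ≠ 0)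
    (htop : ∀ y, ∫⁻ θ, L θ y ∂μ ≠ ∞) : IsMarkovKernel (bayesPosterior μ L) := by
  refine ⟨fun y => ⟨?_⟩⟩
  rw [bayesPosterior_apply μ hL, withDensity_apply _ MeasurableSet.univ, Measure.restrict_univ]
  simp_rw [div_eq_mul_inv]
  rw [lintegral_mul_const _ (by exact hL.comp measurable_prodMk_right),
    ENNReal.mul_inv_cancel (h0 y) (htop y)]

theorem lintegral_bayesPosterior (μ : Measure Θ) [SFinite μ]
    (hL : Measurable (Function.uncurry L)) (y : 𝒴) {g : Θ → ℝ≥0∞} (hg : Measurable g) :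
    ∫⁻ θ, g θ ∂bayesPosterior μ L y = (∫⁻ θ, L θ y ∂μ)⁻¹ * ∫⁻ θ, L θ y * g θ ∂μ := by
  have hy : Measurable fun θ => L θ y := hL.comp measurable_prodMk_right
  rw [bayesPosterior_apply μ hL, lintegral_withDensity_eq_lintegral_mul _ (hy.div_const _) hg,
    ← lintegral_const_mul _ (by exact hy.mul hg)]
  refine lintegral_congr fun θ => ?_
  simp only [Pi.mul_apply, div_eq_mul_inv]
  ring

/-- After Tonelli, integrating `L θ y` over `θ` gives the evidence `p(y)`, which cancels the
posterior's normaliser because it is neither `0` nor `∞`. -/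
theorem compProd_bayesPosterior (μ : Measure Θ) [SFinite μ] (ν : Measure 𝒴) [SFinite ν]
    (hL : Measurable (Function.uncurry L)) (hLtop : ∀ θ y, L θ y ≠ ∞)
    (h0 : ∀ y, ∫⁻ θ, L θ y ∂μ ≠ 0) (htop : ∀ y, ∫⁻ θ, L θ y ∂μ ≠ ∞) :
    (likelihoodKernel ν L ∘ₘ μ) ⊗ₘ bayesPosterior μ L =
      (μ ⊗ₘ likelihoodKernel ν L).map Prod.swap := by
  have := isMarkovKernel_bayesPosterior μ hL h0 htop
  have : IsSFiniteKernel (likelihoodKernel ν L) := Kernel.IsSFiniteKernel.withDensity _ hLtop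
  have hLy (θ : Θ) : Measurable (L θ) := hL.comp measurable_prodMk_left
  refine Measure.ext_of_lintegral _ fun f hf => ?_
  have hg : Measurable fun y => ∫⁻ θ, f (y, θ) ∂bayesPosterior μ L y :=
    Measurable.lintegral_kernel_prod_right' hf
  rw [Measure.lintegral_compProd hf, Measure.lintegral_bind (Kernel.aemeasurable _)
    hg.aemeasurable, lintegral_map hf measurable_swap,
    Measure.lintegral_compProd (by exact hf.comp measurable_swap)]
  simp only [likelihoodKernel_apply ν hL, Prod.swap_prod_mk]
  have h1 (θ : Θ) := lintegral_withDensity_eq_lintegral_mul ν (hLy θ) hg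
  have h2 (θ : Θ) := lintegral_withDensity_eq_lintegral_mul ν (hLy θ)
    (hf.comp (measurable_prodMk_right (y := θ)))
  simp only [Function.comp_def] at h2
  simp only [h1, h2, Pi.mul_apply]
  have hf' : AEMeasurable (Function.uncurry fun θ y => L θ y * f (y, θ)) (μ.prod ν) :=
    (hL.mul (hf.comp measurable_swap)).aemeasurable
  have hg' : AEMeasurable (Function.uncurry fun θ y =>
      L θ y * ∫⁻ θ', f (y, θ') ∂bayesPosterior μ L y) (μ.prod ν) :=
    (hL.mul (hg.comp measurable_snd)).aemeasurable
  refine (lintegral_lintegral_swap hg').trans (Eq.trans ?_ (lintegral_lintegral_swap hf').symm)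
  refine lintegral_congr fun y => ?_
  have hy : Measurable fun θ => L θ y := hL.comp measurable_prodMk_right
  rw [lintegral_mul_const _ hy,
    lintegral_bayesPosterior μ hL y (by exact hf.comp measurable_prodMk_left), ← mul_assoc,
    ENNReal.mul_inv_cancel (h0 y) (htop y), one_mul]

end BayesRule

/-! ### The evidence of a normal likelihood is positive and finite. -/

section NormalLikelihood

variable {E : Type*} {n m : ℕ} (X : Fin n → E) (C : Matrix (Fin m) (Fin n) ℝ)
  {R : Matrix (Fin m) (Fin m) ℝ} (μ : Measure (E → ℝ)) [IsProbabilityMeasure μ]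

theorem lintegral_normalLikelihood_ne_zero (hR : R.PosDef) (y : Fin m → ℝ) :
    ∫⁻ f, normalLikelihood X C R f y ∂μ ≠ 0 := by
  have hm : Measurable fun f : E → ℝ => normalLikelihood X C R f y :=
    (measurable_normalLikelihood X C R).of_uncurry_right
  intro h
  rw [lintegral_eq_zero_iff hm] at h
  obtain ⟨f, hf⟩ := h.exists
  exact (ENNReal.ofReal_pos.2 (mvnPDF_pos hR _)).ne' hf

theorem lintegral_normalLikelihood_ne_top (hR : R.PosDef) (y : Fin m → ℝ) :
    ∫⁻ f, normalLikelihood X C R f y ∂μ ≠ ∞ := by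
  refine ne_top_of_le_ne_top ?_
    (lintegral_mono fun f => ENNReal.ofReal_le_ofReal (mvnPDF_le hR _))
  simp

end NormalLikelihood

/-! ### Posterior parameters and the posterior process. -/

section SkewProcess

variable {E : Type*} {n m s N : ℕ} {μ : Measure (E → ℝ)} {ξ : E → ℝ} {Ω : E → E → ℝ}
  {Δ : E → Fin s → ℝ} {γ : Fin s → ℝ} {Γ : Matrix (Fin s) (Fin s) ℝ}
  {X : Fin n → E} {C : Matrix (Fin m) (Fin n) ℝ} {R : Matrix (Fin m) (Fin m) ℝ}

theorem IsSkewGP.posDef_sunCov (hμ : IsSkewGP μ ξ Ω Δ γ Γ) (hX : Function.Injective X) :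
    (sunCov (scaleMat Ω X) (skewMat Δ X) Γ).PosDef :=
  SkewGaussian.posDef_sunCov (hμ.posDef n X hX)

theorem IsSkewGP.posDef_scaleMat (hμ : IsSkewGP μ ξ Ω Δ γ Γ) (hX : Function.Injective X) :
    (scaleMat Ω X).PosDef :=
  (hμ.posDef_sunCov hX).submatrix Sum.inr_injective

theorem omegaP_eq_condCov (hΩ : (scaleMat Ω X).PosDef) :
    omegaP Ω X C R = condCov (scaleMat Ω X) id C R := by
  have ht : (scaleMat Ω X)ᵀ = scaleMat Ω X := by simpa using hΩ.isHermitian.eq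
  simp [omegaP, condCov, obsCross, obsCov, obsPrec, Matrix.transpose_mul, ht, Matrix.mul_assoc]

theorem posDef_omegaP (hΩ : (scaleMat Ω X).PosDef) (hR : R.PosDef) :
    (omegaP Ω X C R).PosDef := by
  rw [omegaP_eq_condCov hΩ]
  exact posDef_condCov hΩ hR id C

/-- With `Λ = D_Ω Δ` and `P` the observation precision, the last term of `Γ_p` is `Λᵀ Ω⁻¹ Ω_p Ω⁻¹
Λ`, and `Ω⁻¹ Ω_p Ω⁻¹ = Ω⁻¹ - Cᵀ P C`; the terms `Λᵀ Ω⁻¹ Λ` cancel. The outcome is the conditional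
covariance of `t`. -/
theorem capGammaP_eq (hΩ : (scaleMat Ω X).PosDef) (hR : R.PosDef) :
    capGammaP Ω Δ Γ X C R = Γ - (scaleDiag (scaleMat Ω X) * skewMat Δ X)ᵀ *
      (Cᵀ * obsPrec Ω X C R * C) * (scaleDiag (scaleMat Ω X) * skewMat Δ X) := by
  have hp := posDef_omegaP (C := C) hΩ hR
  have ht : (scaleMat Ω X)⁻¹ᵀ = (scaleMat Ω X)⁻¹ := by simpa using hΩ.inv.isHermitian.eq
  have hpt : (omegaP Ω X C R)ᵀ = omegaP Ω X C R := by simpa using hp.isHermitian.eq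
  have hd := fun i => hΩ.diag_pos (i := i)
  have hdp := fun i => hp.diag_pos (i := i)
  have hΩu := (Matrix.isUnit_iff_isUnit_det _).1 hΩ.isUnit
  have hpu := (Matrix.isUnit_iff_isUnit_det _).1 hp.isUnit
  have hD := isUnit_det_scaleDiag hd
  have hDp := isUnit_det_scaleDiag hdp
  have hDt := transpose_scaleDiag (scaleMat Ω X)
  have hDpt := transpose_scaleDiag (omegaP Ω X C R)
  have hmid : (scaleMat Ω X)⁻¹ * omegaP Ω X C R * (scaleMat Ω X)⁻¹ =
      (scaleMat Ω X)⁻¹ - Cᵀ * obsPrec Ω X C R * C := by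
    simp only [omegaP, Matrix.mul_sub, Matrix.sub_mul, Matrix.mul_assoc,
      Matrix.mul_nonsing_inv _ hΩu, Matrix.nonsing_inv_mul_cancel_left _ _ hΩu, Matrix.mul_one]
  have hdelta : deltaP Ω Δ X C R = (scaleDiag (omegaP Ω X C R))⁻¹ *
      (omegaP Ω X C R * ((scaleMat Ω X)⁻¹ * (scaleDiag (scaleMat Ω X) * skewMat Δ X))) := by
    rw [deltaP, corr_inv hd, corr]
    simp only [Matrix.mul_assoc, Matrix.nonsing_inv_mul_cancel_left _ _ hD,
      Matrix.nonsing_inv_mul_cancel_left _ _ hDp]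
  rw [capGammaP, hdelta, corr_inv hdp, corr_inv hd]
  generalize hP : obsPrec Ω X C R = P at *
  generalize omegaP Ω X C R = Ωp at *
  generalize skewMat Δ X = D₀ at *
  generalize scaleMat Ω X = Ω₀ at *
  generalize scaleDiag Ω₀ = S at *
  generalize scaleDiag Ωp = Sp at *
  have h1 : (Sp⁻¹ * (Ωp * (Ω₀⁻¹ * (S * D₀))))ᵀ * (Sp * Ωp⁻¹ * Sp) *
      (Sp⁻¹ * (Ωp * (Ω₀⁻¹ * (S * D₀)))) = (S * D₀)ᵀ * (Ω₀⁻¹ * Ωp * Ω₀⁻¹) * (S * D₀) := by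
    simp only [Matrix.transpose_mul, Matrix.transpose_nonsing_inv, hDt, hDpt, hpt, ht,
      Matrix.mul_assoc, Matrix.mul_nonsing_inv_cancel_left _ _ hDp,
      Matrix.nonsing_inv_mul_cancel_left _ _ hDp, Matrix.nonsing_inv_mul_cancel_left _ _ hpu]
  rw [h1, hmid]
  simp only [Matrix.transpose_mul, hDt, Matrix.mul_sub, Matrix.sub_mul, Matrix.mul_assoc]
  abel

theorem gammaP_eq (hΩ : (scaleMat Ω X).PosDef) (y : Fin m → ℝ) :
    gammaP ξ Ω Δ γ X C R y = γ + ((scaleDiag (scaleMat Ω X) * skewMat Δ X)ᵀ *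
      (Cᵀ * obsPrec Ω X C R)) *ᵥ (y - C *ᵥ locVec ξ X) := by
  have hd := fun i => hΩ.diag_pos (i := i)
  have hΩu := (Matrix.isUnit_iff_isUnit_det _).1 hΩ.isUnit
  have hD := isUnit_det_scaleDiag hd
  have hDt := transpose_scaleDiag (scaleMat Ω X)
  rw [gammaP, xiP, add_sub_cancel_left, corr_inv hd, Matrix.mulVec_mulVec]
  simp only [Matrix.transpose_mul, hDt, Matrix.mul_assoc,
    Matrix.mul_nonsing_inv_cancel_left _ _ hD, Matrix.nonsing_inv_mul_cancel_left _ _ hΩu]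

/-- Test and training points may overlap, whereas the finite-dimensional laws are given only at
distinct points; hence the union is enumerated. -/
theorem exists_enumeration {k : ℕ} (T : Fin k → E) (X : Fin n → E) :
    ∃ (N : ℕ) (Z : Fin N → E) (a : Fin k → Fin N) (b : Fin n → Fin N),
      Function.Injective Z ∧ Z ∘ a = T ∧ Z ∘ b = X := by
  classical
  let S : Finset E := Finset.univ.image T ∪ Finset.univ.image X
  refine ⟨S.card, fun i => S.equivFin.symm i, fun i => S.equivFin ⟨T i, by simp [S]⟩,
    fun i => S.equivFin ⟨X i, by simp [S]⟩,
    Subtype.val_injective.comp S.equivFin.symm.injective, ?_, ?_⟩ <;>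
  · ext i
    simp

theorem obsCross_sunCov_submatrix_inl (Z : Fin N → E) (b : Fin n → Fin N) :
    (obsCross (sunCov (scaleMat Ω Z) (skewMat Δ Z) Γ) (Sum.inr ∘ b) C).submatrix id Sum.inl =
      -(C * (scaleDiag (scaleMat Ω (Z ∘ b)) * skewMat Δ (Z ∘ b))) := by
  rw [← Matrix.mul_neg, obsCross_submatrix]
  congr 1
  ext i j
  simp [sunCov, scaleDiag_mul_apply, scaleMat, skewMat]

/-- The scale, skewness and `Γ_p` formulas are read off from the blocks of a single conditional
covariance of `(t, f(T))`. -/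
theorem condCov_submatrix_eq (hμ : IsSkewGP μ ξ Ω Δ γ Γ) (hR : R.PosDef) {Z : Fin N → E}
    (hZ : Function.Injective Z) (b : Fin n → Fin N) (hb : Function.Injective b) {k : ℕ}
    {a : Fin k → Fin N} (ha : Function.Injective a) :
    (condCov (sunCov (scaleMat Ω Z) (skewMat Δ Z) Γ) (Sum.inr ∘ b) C R).submatrix
        (Sum.map id a) (Sum.map id a) =
      sunCov (scaleMat (postScale Ω (Z ∘ b) C R) (Z ∘ a))
        (skewMat (postSkew Ω Δ (Z ∘ b) C R) (Z ∘ a)) (capGammaP Ω Δ Γ (Z ∘ b) C R) := by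
  have hM := hμ.posDef_sunCov hZ
  have hΩX : (scaleMat Ω (Z ∘ b)).PosDef := hμ.posDef_scaleMat (hZ.comp hb)
  have hsymm (i j : Fin N) : Ω (Z i) (Z j) = Ω (Z j) (Z i) := by
    simpa [scaleMat] using ((hμ.posDef_scaleMat hZ).isHermitian.apply i j).symm
  set M := sunCov (scaleMat Ω Z) (skewMat Δ Z) Γ with hMdef
  set N' := (condCov M (Sum.inr ∘ b) C R).submatrix (Sum.map id a) (Sum.map id a) with hN'
  have hN : N'.PosDef := (posDef_condCov hM hR _ C).submatrix (Function.injective_id.sumMap ha)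
  set Λ := scaleDiag (scaleMat Ω (Z ∘ b)) * skewMat Δ (Z ∘ b) with hΛ
  set P := obsPrec Ω (Z ∘ b) C R with hP
  let V : Matrix (Fin n) (Fin k) ℝ := Matrix.of fun i j => Ω (Z (b i)) (Z (a j))
  have hQl : (obsCross M (Sum.inr ∘ b) C).submatrix id Sum.inl = -(C * Λ) :=
    obsCross_sunCov_submatrix_inl Z b
  have hQr : (obsCross M (Sum.inr ∘ b) C).submatrix id (Sum.inr ∘ a) = C * V := rfl
  have hS : (obsCov M (Sum.inr ∘ b) C R)⁻¹ = P := rfl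
  have h11 : N'.toBlocks₁₁ = capGammaP Ω Δ Γ (Z ∘ b) C R := by
    have h : N'.toBlocks₁₁ = (condCov M (Sum.inr ∘ b) C R).submatrix Sum.inl Sum.inl := rfl
    have hΓ : M.submatrix Sum.inl Sum.inl = Γ := rfl
    rw [capGammaP_eq hΩX hR, h, condCov_submatrix, hQl, hS, hΓ]
    simp [Matrix.transpose_mul, Matrix.mul_assoc, hΛ, hP]
  have h22 : N'.toBlocks₂₂ = scaleMat (postScale Ω (Z ∘ b) C R) (Z ∘ a) := by
    have h : N'.toBlocks₂₂ =
      (condCov M (Sum.inr ∘ b) C R).submatrix (Sum.inr ∘ a) (Sum.inr ∘ a) := rfl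
    have hT : M.submatrix (Sum.inr ∘ a) (Sum.inr ∘ a) = scaleMat Ω (Z ∘ a) := rfl
    have hV : (C * V)ᵀ * P * (C * V) = Vᵀ * ((Cᵀ * P * C) * V) := by
      simp only [Matrix.transpose_mul, Matrix.mul_assoc]
    rw [h, condCov_submatrix, hQr, hS, hT, hV]
    ext i j
    simp only [scaleMat, Matrix.of_apply, postScale, Matrix.sub_apply, Function.comp_apply]
    congr 1
    rw [Matrix.mul_apply, dotProduct]
    refine Finset.sum_congr rfl fun l _ => ?_
    simp only [V, Matrix.transpose_apply, Matrix.of_apply, crossScale, Function.comp_apply,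
      hsymm (b l) (a i)]
    rfl
  have h21 : N'.toBlocks₂₁ = -(scaleDiag (scaleMat (postScale Ω (Z ∘ b) C R) (Z ∘ a)) *
      skewMat (postSkew Ω Δ (Z ∘ b) C R) (Z ∘ a)) := by
    have h : N'.toBlocks₂₁ =
      (condCov M (Sum.inr ∘ b) C R).submatrix (Sum.inr ∘ a) Sum.inl := rfl
    have hT : M.submatrix (Sum.inr ∘ a) Sum.inl =
      -(scaleDiag (scaleMat Ω Z) * skewMat Δ Z).submatrix a id := rfl
    have hV : (C * V)ᵀ * P * -(C * Λ) = -(Vᵀ * (Cᵀ * P * C * Λ)) := by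
      simp only [Matrix.transpose_mul, Matrix.mul_assoc, Matrix.mul_neg]
    rw [h, condCov_submatrix, hQr, hQl, hS, hT, hV]
    ext i j
    -- `postSkew` divides by this root; it cancels against the scaling in `sunCov` only when
    -- nonzero.
    have hpos : √(postScale Ω (Z ∘ b) C R (Z (a i)) (Z (a i))) ≠ 0 := by
      have h := hN.diag_pos (i := Sum.inr i)
      have h' : N' (Sum.inr i) (Sum.inr i) = N'.toBlocks₂₂ i i := rfl
      rw [h', h22] at h
      exact (Real.sqrt_pos.2 h).ne'
    have hsum : (Vᵀ * (Cᵀ * P * C * Λ)) i j =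
        (crossScale Ω (Z (a i)) (Z ∘ b) ᵥ* (Cᵀ * P * C * scaleDiag (scaleMat Ω (Z ∘ b)) *
          skewMat Δ (Z ∘ b))) j := by
      rw [Matrix.mul_apply, Matrix.vecMul, dotProduct]
      refine Finset.sum_congr rfl fun l _ => ?_
      simp only [V, Matrix.transpose_apply, Matrix.of_apply, crossScale, Function.comp_apply,
        hsymm (b l) (a i), hΛ, Matrix.mul_assoc]
    simp only [Matrix.sub_apply, Matrix.neg_apply, hsum, Matrix.submatrix_apply,
      scaleDiag_mul_apply, id_eq]
    simp only [scaleMat, skewMat, Matrix.of_apply, postSkew, Pi.sub_apply, Pi.smul_apply,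
      smul_eq_mul, Function.comp_apply, ← hP]
    field_simp
    ring
  have h12 : N'.toBlocks₁₂ = N'.toBlocks₂₁ᵀ := by
    have h := hN.isHermitian
    rw [← N'.fromBlocks_toBlocks, Matrix.isHermitian_fromBlocks_iff] at h
    exact h.2.2.1.symm
  rw [← N'.fromBlocks_toBlocks, h12, h11, h21, h22, sunCov, Matrix.transpose_neg]

/-- The posterior is computed at the points `Z`, where the likelihood is a function of the finite
vector, and then marginalised to `T`. -/
theorem isSkewGP_bayesPosterior [IsProbabilityMeasure μ] (hμ : IsSkewGP μ ξ Ω Δ γ Γ)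
    (hX : Function.Injective X) (hR : R.PosDef) (y : Fin m → ℝ) :
    IsSkewGP (bayesPosterior μ (normalLikelihood X C R) y)
      (postLoc ξ Ω X C R y) (postScale Ω X C R) (postSkew Ω Δ X C R)
      (gammaP ξ Ω Δ γ X C R y) (capGammaP Ω Δ Γ X C R) := by
  have hL := measurable_normalLikelihood X C R
  have hmarkov := isMarkovKernel_bayesPosterior μ hL
    (lintegral_normalLikelihood_ne_zero X C μ hR) (lintegral_normalLikelihood_ne_top X C μ hR)
  suffices h : ∀ (k : ℕ) (T : Fin k → E), Function.Injective T →
      (sunMatrix (scaleMat (postScale Ω X C R) T) (skewMat (postSkew Ω Δ X C R) T)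
        (capGammaP Ω Δ Γ X C R)).PosDef ∧
      (bayesPosterior μ (normalLikelihood X C R) y).map (fun f i => f (T i)) =
        sun (locVec (postLoc ξ Ω X C R y) T) (scaleMat (postScale Ω X C R) T)
          (skewMat (postSkew Ω Δ X C R) T) (gammaP ξ Ω Δ γ X C R y) (capGammaP Ω Δ Γ X C R) from
    ⟨fun k T hT => (h k T hT).1, fun k T hT => (h k T hT).2⟩
  intro k T hT
  obtain ⟨N, Z, a, b, hZ, rfl, rfl⟩ := exists_enumeration T X
  have ha : Function.Injective a := hT.of_comp
  have hb : Function.Injective b := hX.of_comp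
  have hM := hμ.posDef_sunCov hZ
  have hcond := condCov_submatrix_eq (C := C) hμ hR hZ b hb ha
  have hpd := (posDef_condCov hM hR (Sum.inr ∘ b) C).submatrix
    (Function.injective_id.sumMap ha)
  rw [hcond] at hpd
  have hpd' := (posDef_sunMatrix_iff fun i => hpd.diag_pos (i := Sum.inr i)).2 hpd
  refine ⟨hpd', ?_⟩
  set p := ∫⁻ f, normalLikelihood (Z ∘ b) C R f y ∂μ with hp
  let u : Fin s ⊕ Fin N → ℝ :=
    ((obsCross (sunCov (scaleMat Ω Z) (skewMat Δ Z) Γ) (Sum.inr ∘ b) C)ᵀ *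
      (obsCov (sunCov (scaleMat Ω Z) (skewMat Δ Z) Γ) (Sum.inr ∘ b) C R)⁻¹) *ᵥ
        (y - C *ᵥ (locVec ξ Z ∘ b))
  have hγ : γ - u ∘ Sum.inl = gammaP ξ Ω Δ γ (Z ∘ b) C R y := by
    have hu : u ∘ Sum.inl =
        (((obsCross (sunCov (scaleMat Ω Z) (skewMat Δ Z) Γ) (Sum.inr ∘ b) C).submatrix id
          Sum.inl)ᵀ * obsPrec Ω (Z ∘ b) C R) *ᵥ (y - C *ᵥ locVec ξ (Z ∘ b)) := rfl
    rw [gammaP_eq (hμ.posDef_scaleMat hX), hu, obsCross_sunCov_submatrix_inl, Matrix.transpose_neg, Matrix.neg_mul, Matrix.neg_mulVec,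
      sub_neg_eq_add, Matrix.transpose_mul C, Matrix.mul_assoc]
  have hξ : (locVec ξ Z + u ∘ Sum.inr) ∘ a = locVec (postLoc ξ Ω (Z ∘ b) C R y) (Z ∘ a) := by
    ext i
    change ξ (Z (a i)) + u (Sum.inr (a i)) = ξ (Z (a i)) + _
    congr 1
    change (((C * (scaleMat Ω Z).submatrix b id)ᵀ * obsPrec Ω (Z ∘ b) C R) *ᵥ
      (y - C *ᵥ locVec ξ (Z ∘ b))) (a i) = _
    rw [Matrix.transpose_mul, Matrix.mul_assoc, ← Matrix.mulVec_mulVec]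
    rw [Matrix.mulVec]
    congr 1
    ext l
    simpa [crossScale, scaleMat] using ((hμ.posDef_scaleMat hZ).isHermitian.apply (a i) (b l))
  have hZm : Measurable fun (f : E → ℝ) (i : Fin N) => f (Z i) := by fun_prop
  let h (z : Fin N → ℝ) : ℝ≥0∞ := ENNReal.ofReal (mvnPDF R (y - C *ᵥ (z ∘ b)))
  have hh : Measurable h := by
    have : Continuous fun z : Fin N → ℝ => y - C *ᵥ (z ∘ b) := by
      have : Continuous fun z : Fin N → ℝ => z ∘ b := by fun_prop
      fun_prop
    exact (measurable_ofReal_mvnPDF R).comp this.measurable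
  have hpost : (bayesPosterior μ (normalLikelihood (Z ∘ b) C R) y).map (fun f i => f (Z i)) =
      p⁻¹ • (sun (locVec ξ Z) (scaleMat Ω Z) (skewMat Δ Z) γ Γ).withDensity h := by
    rw [← hμ.map_eq N Z hZ, ← withDensity_smul _ hh, withDensity_map μ hZm (hh.const_smul _),
      bayesPosterior_apply μ hL]
    congr 2
    funext f
    rw [div_eq_mul_inv, mul_comm]
    rfl
  have hsun := sun_eq_smul_selectionLaw hpd' (locVec (postLoc ξ Ω (Z ∘ b) C R y) (Z ∘ a))
    (gammaP ξ Ω Δ γ (Z ∘ b) C R y)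
  -- Proportionality suffices: both laws have total mass one, which forces `c = 1`.
  have hmain : ∃ c : ℝ≥0∞,
      (bayesPosterior μ (normalLikelihood (Z ∘ b) C R) y).map (fun f i => f ((Z ∘ a) i)) =
        c • sun (locVec (postLoc ξ Ω (Z ∘ b) C R y) (Z ∘ a))
          (scaleMat (postScale Ω (Z ∘ b) C R) (Z ∘ a))
          (skewMat (postSkew Ω Δ (Z ∘ b) C R) (Z ∘ a)) (gammaP ξ Ω Δ γ (Z ∘ b) C R y)
          (capGammaP Ω Δ Γ (Z ∘ b) C R) := by
    have hΓ : (capGammaP Ω Δ Γ (Z ∘ b) C R).PosDef := hpd.submatrix Sum.inl_injective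
    have h0 := (ENNReal.ofReal_pos.2 (mvnCDF_pos hΓ (gammaP ξ Ω Δ γ (Z ∘ b) C R y))).ne'
    have hcomp : (fun (f : E → ℝ) (i : Fin k) => f ((Z ∘ a) i)) =
        (fun z : Fin N → ℝ => z ∘ a) ∘ fun (f : E → ℝ) (i : Fin N) => f (Z i) := rfl
    rw [hcomp, ← Measure.map_map (measurable_comp_left a) hZm, hpost,
      sun_eq_smul_selectionLaw (hμ.posDef N Z hZ), withDensity_smul_measure,
      selectionLaw_withDensity hM hR γ (locVec ξ Z) b C y (u := u) rfl, hγ]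
    simp only [Measure.map_smul]
    rw [selectionLaw_map_comp (posDef_condCov hM hR _ C) _ _ ha, hcond, hξ,
      ← one_smul ℝ≥0∞ (selectionLaw _ _ _), ← ENNReal.mul_inv_cancel h0 ENNReal.ofReal_ne_top,
      mul_smul, ← hsun]
    simp only [smul_smul]
    exact ⟨_, rfl⟩
  obtain ⟨c, hc⟩ := hmain
  have hTm : Measurable fun (f : E → ℝ) (i : Fin k) => f ((Z ∘ a) i) := by fun_prop
  have h1 := congrArg (fun ν => ν Set.univ) hc
  simp only [Measure.smul_apply, sun_univ hpd', smul_eq_mul, mul_one,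
    Measure.map_apply hTm MeasurableSet.univ, Set.preimage_univ, measure_univ] at h1
  rw [hc, ← h1, one_smul]

end SkewProcess

end SkewGaussian

end

theorem theorem1 {d s n m : ℕ}
    (ξ : EuclideanSpace ℝ (Fin d) → ℝ)
    (Ω : EuclideanSpace ℝ (Fin d) → EuclideanSpace ℝ (Fin d) → ℝ)
    (Δ : EuclideanSpace ℝ (Fin d) → Fin s → ℝ)
    (γ : Fin s → ℝ) (Γ : Matrix (Fin s) (Fin s) ℝ)
    (μ : Measure (EuclideanSpace ℝ (Fin d) → ℝ)) [IsProbabilityMeasure μ]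
    (hμ : IsSkewGP μ ξ Ω Δ γ Γ)
    (X : Fin n → EuclideanSpace ℝ (Fin d)) (hX : Function.Injective X)
    (C : Matrix (Fin m) (Fin n) ℝ) (R : Matrix (Fin m) (Fin m) ℝ) (hR : R.PosDef) :
    -- the posterior `p(f ∣ y)` given by Bayes' rule is a probability law for every `y` and is the
    -- conditional law of `f` given the observation
    IsMarkovKernel (bayesPosterior μ (normalLikelihood X C R)) ∧
    (likelihoodKernel volume (normalLikelihood X C R) ∘ₘ μ) ⊗ₘ
        bayesPosterior μ (normalLikelihood X C R) =
      (μ ⊗ₘ likelihoodKernel volume (normalLikelihood X C R)).map Prod.swap ∧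
    -- and for every `y` it is the law of a skew-Gaussian process with the stated parameters
    ∀ y : Fin m → ℝ,
      IsSkewGP (bayesPosterior μ (normalLikelihood X C R) y)
        (postLoc ξ Ω X C R y) (postScale Ω X C R) (postSkew Ω Δ X C R)
        (gammaP ξ Ω Δ γ X C R y) (capGammaP Ω Δ Γ X C R) := by
  have hL := measurable_normalLikelihood X C R
  have h0 := lintegral_normalLikelihood_ne_zero X C μ hR
  have htop := lintegral_normalLikelihood_ne_top X C μ hR
  exact ⟨isMarkovKernel_bayesPosterior μ hL h0 htop,
    compProd_bayesPosterior μ volume hL (fun _ _ => ENNReal.ofReal_ne_top) h0 htop,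
    isSkewGP_bayesPosterior hμ hX hR⟩
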